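/- Let $\mathbf T=\mathbf R/\mathbf Z$ and $\xi_n(x)=e^{2\pi i n x}$. On $L^2(\mathbf T)$ let $(M f)(x)=\xi_1(x)f(x)$ and $(R(\alpha)f)(x)=f(x+\alpha)$, and write $\Re A=\frac12(A+A^*)$. Put $$H(\alpha,\lambda,\theta)=2\Re M+2\lambda\,\Re(\xi_1(\theta)R(\alpha)),\quad\text{i.e. } H\xi_n=\xi_{n+1}+\xi_{n-1}+2\lambda\cos[2\pi(n\alpha+\theta)]\,\xi_n,$$ $$U_H(\kappa,\alpha,\lambda,\theta)=e^{-i\kappa H(\alpha,\lambda,\theta)},\qquad U_{kH}(\kappa,\alpha,\lambda,\theta)=e^{-2i\kappa\Re M}\,e^{-2i\kappa\lambda\Re(\xi_1(\theta)R(\alpha))}.$$ Let $\mathcal A_\alpha$ be the universal unital $C^*$-algebra generated by unitaries $\widetilde U_\alpha,\widetilde V_\alpha$ with $\widetilde U_\alpha\widetilde V_\alpha=e^{2\pi i\alpha}\widetilde V_\alpha\widetilde U_\alpha$, and define in it the mother operators $$\widetilde U_H(\kappa,\alpha,\lambda)=e^{-2i\kappa\Re\widetilde V_\alpha-2i\kappa\lambda\Re\widetilde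 U_\alpha},\qquad \widetilde U_{kH}(\kappa,\alpha,\lambda)=e^{-2i\kappa\Re\widetilde V_\alpha}\,e^{-2i\kappa\lambda\Re\widetilde U_\alpha}.$$ Let $\alpha=p/q$ with $p\in\mathbf Z$, $q\in\mathbf N=\{1,2,\dots\}$ coprime, and let $\kappa,\lambda\in\mathbf R$. Let $F=q^{-1/2}(e^{2\pi i jk/q})_{0\le j,k<q}$, $c(y)=\cos(2\pi y)$, and let $G(k,y)$ be the $q\times q$ diagonal matrix with entries $c(y+kj/q)$, $0\le j<q$. For $x,\theta\in\mathbf R$ define $$M_{U_H}(x,\theta)=\exp\big[-2i\kappa\,(G(1,x)+\lambda F\,G(p,\theta)\,F^{-1})\big],$$ $$M_{U_{kH}}(x,\theta)=\exp[-2i\kappa\,G(1,x)]\;F\,\exp[-2i\kappa\lambda\,G(p,\theta)]\,F^{-1}.$$ **Theorem.** 1. For all $x,\theta$, let $E=\mathrm{diag}(e^{-2i\kappa c(x+j/q)})_{0\le j<q}$ and $E'=\mathrm{diag}(e^{-2i\kappa\lambda c(\theta+pj/q)})_{0\le j<q}$. Then $M_{U_{kH}}(x,\theta)$ is unitarily equivalent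 to $F^{-1}E\,F\,E'$, and $F^{-1}E\,F\,E'=V E'$, where $V$ is the circulant matrix with first row $(v_1,\dots,v_q)$ (each row is the previous one shifted cyclically one place to the right) and $(v_1,\dots,v_q)^T=q^{-1/2}F\,(e^{-2i\kappa c(x+j/q)})_{0\le j<q}^T$. 2. For every $\theta\in\mathbf R$, $\sigma(U_H(\kappa,\alpha,\lambda,\theta))=\bigcup_{x\in[0,1/q)}\sigma(M_{U_H}(x,\theta))$ and $\sigma(U_{kH}(\kappa,\alpha,\lambda,\theta))=\bigcup_{x\in[0,1/q)}\sigma(M_{U_{kH}}(x,\theta))$. 3. For $N\ge1$ and $0\le x_0<\frac1{Nq}$, replace $[0,1/q)$ in these unions by the uniform $N$-point grid $\{x_0+\frac{j}{Nq}:0\le j<N\}$. Each resulting estimate $\sigma_N$ of the spectrum is within Hausdorff distance $\frac{2\pi|\kappa|}{Nq}$ of $\sigma(U_H(\kappa,\alpha,\lambda,\theta))$, respectively $\sigma(U_{kH}(\kappa,\alpha,\lambda,\theta))$. 4. $\sigma(\widetilde U_H(\kappa,\alpha,\lambda))=\bigcup_{x,\theta\in[0,1/q)}\sigma(M_{U_H}(x,\theta))$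 and $\sigma(\widetilde U_{kH}(\kappa,\alpha,\lambda))=\bigcup_{x,\theta\in[0,1/q)}\sigma(M_{U_{kH}}(x,\theta))$. 5. For $N\ge1$ and $0\le x_0,\theta_0<\frac1{Nq}$, replace $[0,1/q)^2$ in these unions by the uniform $N\times N$ grid $\{(x_0+\frac{j}{Nq},\theta_0+\frac{k}{Nq}):0\le j,k<N\}$. Each resulting estimate $\sigma_{N\times N}$ is within Hausdorff distance $\frac{2\pi|\kappa|(1+|\lambda|)}{Nq}$ of $\sigma(\widetilde U_H(\kappa,\alpha,\lambda))$, respectively $\sigma(\widetilde U_{kH}(\kappa,\alpha,\lambda))$. -/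

import Mathlib

noncomputable section

open MeasureTheory Complex
open scoped ENNReal CStarAlgebra

namespace RotationAlgebra

/-! ### Frames and the universal rotation `C*`-algebra -/

/-- `(U, V)` is a pair of unitaries of the unital `C*`-algebra `A` with
`U V = exp (2 π i α) V U`. -/
structure IsFrame {A : Type*} [CStarAlgebra A] (α : ℝ) (U V : A) : Prop where
  unitary_left : U ∈ unitary A
  unitary_right : V ∈ unitary A
  comm : U * V = Complex.exp (2 * Real.pi * I * α) • (V * U)

/-- A frame with parameter `α` in some nonzero unital `C*`-algebra. -/
structure Frame (α : ℝ) where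
  alg : Type
  [cstar : CStarAlgebra alg]
  [nontriv : Nontrivial alg]
  U : alg
  V : alg
  isFrame : IsFrame α U V

attribute [instance] Frame.cstar Frame.nontriv

variable (α : ℝ)

/-- The `ℓ^∞`-product of the algebras of all frames with parameter `α`. -/
abbrev FrameProduct : Type 1 := lp (fun i : Frame α => i.alg) ∞

instance : CStarAlgebra (FrameProduct α) where

theorem norm_le_one_of_mem_unitary {A : Type*} [CStarAlgebra A] [Nontrivial A] {u : A}
    (hu : u ∈ unitary A) : ‖u‖ ≤ 1 :=
  (CStarRing.norm_of_mem_unitary hu).le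

/-- The family of all first components, `(U_i)_i`. -/
def bigU : FrameProduct α :=
  ⟨fun i => i.U, memℓp_infty ⟨1, by
    rintro _ ⟨i, rfl⟩; exact norm_le_one_of_mem_unitary i.isFrame.unitary_left⟩⟩

/-- The family of all second components, `(V_i)_i`. -/
def bigV : FrameProduct α :=
  ⟨fun i => i.V, memℓp_infty ⟨1, by
    rintro _ ⟨i, rfl⟩; exact norm_le_one_of_mem_unitary i.isFrame.unitary_right⟩⟩

theorem bigFrame : IsFrame α (bigU α) (bigV α) where
  unitary_left := by
    refine Unitary.mem_iff.2 ⟨lp.ext (funext fun i => ?_), lp.ext (funext fun i => ?_)⟩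
    · exact (Unitary.mem_iff.1 i.isFrame.unitary_left).1
    · exact (Unitary.mem_iff.1 i.isFrame.unitary_left).2
  unitary_right := by
    refine Unitary.mem_iff.2 ⟨lp.ext (funext fun i => ?_), lp.ext (funext fun i => ?_)⟩
    · exact (Unitary.mem_iff.1 i.isFrame.unitary_right).1
    · exact (Unitary.mem_iff.1 i.isFrame.unitary_right).2
  comm := lp.ext (funext fun i => i.isFrame.comm)

/-- The `C*`-subalgebra of `FrameProduct α` generated by the tautological frame. -/
def universalSubalgebra : StarSubalgebra ℂ (FrameProduct α) :=
  (StarAlgebra.adjoin ℂ {bigU α, bigV α}).topologicalClosure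

instance : IsClosed (universalSubalgebra α : Set (FrameProduct α)) :=
  StarSubalgebra.isClosed_topologicalClosure _

/-- The universal rotation `C*`-algebra `A_α`: the norm of a `*`-polynomial in its frame is the
supremum of the norms of that polynomial over all frames with parameter `α`. (Every frame generates
a separable algebra, so frames in algebras in `Type` are all frames up to isomorphism.) Its
universal property is `existsUnique_hom`. -/
def UniversalAlgebra : Type 1 := universalSubalgebra α

instance : CStarAlgebra (UniversalAlgebra α) :=
  inferInstanceAs (CStarAlgebra (universalSubalgebra α))

/-- The first generator of `A_α`. -/
def univU : UniversalAlgebra α :=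
  ⟨bigU α, StarSubalgebra.le_topologicalClosure _ (StarAlgebra.subset_adjoin ℂ _ (by simp))⟩

/-- The second generator of `A_α`. -/
def univV : UniversalAlgebra α :=
  ⟨bigV α, StarSubalgebra.le_topologicalClosure _ (StarAlgebra.subset_adjoin ℂ _ (by simp))⟩

theorem univ_isFrame : IsFrame α (univU α) (univV α) where
  unitary_left := Unitary.mem_iff.2
    ⟨Subtype.ext (Unitary.mem_iff.1 (bigFrame α).unitary_left).1,
      Subtype.ext (Unitary.mem_iff.1 (bigFrame α).unitary_left).2⟩
  unitary_right := Unitary.mem_iff.2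
    ⟨Subtype.ext (Unitary.mem_iff.1 (bigFrame α).unitary_right).1,
      Subtype.ext (Unitary.mem_iff.1 (bigFrame α).unitary_right).2⟩
  comm := Subtype.ext (bigFrame α).comm

/-- The frame `(univU α, univV α)` generates `A_α` as a `C*`-algebra. -/
theorem univ_generates :
    (StarAlgebra.adjoin ℂ {univU α, univV α}).topologicalClosure = ⊤ := by
  refine eq_top_iff.2 fun a _ => ?_
  have himg : ((↑) : universalSubalgebra α → FrameProduct α) ''
      (StarAlgebra.adjoin ℂ {univU α, univV α} : StarSubalgebra ℂ (universalSubalgebra α)) =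
      (StarAlgebra.adjoin ℂ {bigU α, bigV α} : StarSubalgebra ℂ (FrameProduct α)) := by
    have h := StarAlgHom.map_adjoin (universalSubalgebra α).subtype {univU α, univV α}
    have h' : (universalSubalgebra α).subtype '' {univU α, univV α} = {bigU α, bigV α} :=
      Set.image_pair (universalSubalgebra α).subtype (univU α) (univV α)
    rw [h'] at h
    exact congrArg (fun S : StarSubalgebra ℂ (FrameProduct α) => (S : Set (FrameProduct α))) h
  have h (a : universalSubalgebra α) : a ∈ closure ((StarAlgebra.adjoin ℂ {univU α, univV α} :
      StarSubalgebra ℂ (universalSubalgebra α)) : Set (universalSubalgebra α)) := by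
    rw [closure_subtype, himg]
    exact a.2
  exact h a

/-- Evaluation of an element of `A_α` at a frame. -/
def evalFrame (i : Frame α) : UniversalAlgebra α →⋆ₐ[ℂ] i.alg where
  toFun a := (a.1 : ∀ i : Frame α, i.alg) i
  map_one' := rfl
  map_mul' _ _ := rfl
  map_zero' := rfl
  map_add' _ _ := rfl
  commutes' _ := rfl
  map_star' _ := rfl

/-- The universal property of `A_α`. -/
theorem existsUnique_hom {B : Type} [CStarAlgebra B] {U V : B} (h : IsFrame α U V) :
    ∃! π : UniversalAlgebra α →⋆ₐ[ℂ] B, π (univU α) = U ∧ π (univV α) = V := by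
  refine existsUnique_of_exists_of_unique ?_ ?_
  · rcases subsingleton_or_nontrivial B with hB | hB
    · exact ⟨{ toFun := fun _ => 0
               map_one' := Subsingleton.elim _ _
               map_mul' := fun _ _ => Subsingleton.elim _ _
               map_zero' := Subsingleton.elim _ _
               map_add' := fun _ _ => Subsingleton.elim _ _
               commutes' := fun _ => Subsingleton.elim _ _
               map_star' := fun _ => Subsingleton.elim _ _ },
        Subsingleton.elim _ _, Subsingleton.elim _ _⟩
    · exact ⟨evalFrame α ⟨B, U, V, h⟩, rfl, rfl⟩
  · rintro f g ⟨hfU, hfV⟩ ⟨hgU, hgV⟩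
    have h1 : StarAlgebra.adjoin ℂ {univU α, univV α} ≤ StarAlgHom.equalizer f g := by
      refine StarAlgHom.adjoin_le_equalizer f g ?_
      rintro x (rfl | rfl)
      · rw [hfU, hgU]
      · rw [hfV, hgV]
    have h2 := StarSubalgebra.topologicalClosure_minimal h1
      (isClosed_eq (map_continuous f) (map_continuous g))
    rw [univ_generates] at h2
    exact StarAlgHom.ext fun a => h2 (show a ∈ (⊤ : StarSubalgebra ℂ (UniversalAlgebra α)) from
      trivial)

end RotationAlgebra

/-! ### Harper operators on `L²(𝕋)` -/

namespace Harper

open RotationAlgebra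

/-- `L²(𝕋)`, `𝕋 = ℝ / ℤ`. -/
abbrev L2T : Type := Lp ℂ 2 (AddCircle.haarAddCircle (T := (1 : ℝ)))

/-- Multiplication by `g ∈ L^∞(𝕋)`. -/
def mulOp (g : Lp ℂ ∞ (AddCircle.haarAddCircle (T := (1 : ℝ)))) : L2T →L[ℂ] L2T :=
  (ContinuousLinearMap.mul ℂ ℂ).holderL (AddCircle.haarAddCircle (T := (1 : ℝ))) ∞ 2 2 g

/-- The rotation `(R(α) f)(x) = f (x + α)`. -/
def rotOp (α : ℝ) : L2T →L[ℂ] L2T :=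
  (Lp.compMeasurePreservingₗᵢ ℂ (fun x : AddCircle (1 : ℝ) => x + (α : AddCircle (1 : ℝ)))
    (measurePreserving_add_right _ _)).toContinuousLinearMap

/-- The self-adjoint operator `cos (2 π x) = Re M(ξ₁)`, where `ξ₁(x) = exp (2 π i x)`. -/
def cosPos : L2T →L[ℂ] L2T := (realPart (mulOp (fourierLp ∞ 1)) : L2T →L[ℂ] L2T)

/-- The self-adjoint operator `cos (-i α d/dx + 2 π θ) = Re (ξ₁(θ) R(α))`. -/
def cosMom (α θ : ℝ) : L2T →L[ℂ] L2T :=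
  (realPart (Complex.exp (2 * Real.pi * I * θ) • rotOp α) : L2T →L[ℂ] L2T)

/-- The almost Mathieu (Harper) operator `H(α, λ, θ)`. -/
def harperH (α lam θ : ℝ) : L2T →L[ℂ] L2T :=
  (2 : ℂ) • cosPos + (2 * lam : ℂ) • cosMom α θ

/-- The unitary Harper operator `U_H(κ, α, λ, θ)`. -/
def unitaryHarper (κ α lam θ : ℝ) : L2T →L[ℂ] L2T :=
  NormedSpace.exp ((-I * κ) • harperH α lam θ)

/-- The kicked Harper operator `U_kH(κ, α, λ, θ)`. -/
def kickedHarper (κ α lam θ : ℝ) : L2T →L[ℂ] L2T :=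
  NormedSpace.exp ((-2 * I * κ) • cosPos) * NormedSpace.exp ((-2 * I * κ * lam) • cosMom α θ)

theorem mulOp_coeFn (g : Lp ℂ ∞ (AddCircle.haarAddCircle (T := (1 : ℝ)))) (f : L2T) :
    mulOp g f =ᵐ[AddCircle.haarAddCircle] fun x => g x * f x :=
  (ContinuousLinearMap.mul ℂ ℂ).coeFn_holder g f

theorem rotOp_coeFn (α : ℝ) (f : L2T) :
    rotOp α f =ᵐ[AddCircle.haarAddCircle] fun x => f (x + (α : AddCircle (1 : ℝ))) :=
  Lp.coeFn_compMeasurePreserving f (measurePreserving_add_right _ _)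

theorem star_mulOp : star (mulOp (fourierLp ∞ 1)) = mulOp (fourierLp ∞ (-1)) := by
  symm
  rw [ContinuousLinearMap.star_eq_adjoint, ContinuousLinearMap.eq_adjoint_iff]
  intro f g
  rw [L2.inner_def, L2.inner_def]
  refine integral_congr_ae ?_
  filter_upwards [mulOp_coeFn (fourierLp ∞ (-1)) f, mulOp_coeFn (fourierLp ∞ 1) g,
    coeFn_fourierLp (T := (1 : ℝ)) ∞ (-1), coeFn_fourierLp (T := (1 : ℝ)) ∞ 1] with x h1 h2 h3 h4
  rw [h1, h2, h3, h4, fourier_neg]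
  simp only [RCLike.inner_apply, map_mul, Complex.conj_conj]
  ring

theorem mulOp_apply (k n : ℤ) :
    mulOp (fourierLp ∞ k) (fourierLp 2 n) = fourierLp 2 (n + k) := by
  refine Lp.ext ?_
  filter_upwards [mulOp_coeFn (fourierLp ∞ k) (fourierLp 2 n),
    coeFn_fourierLp (T := (1 : ℝ)) ∞ k, coeFn_fourierLp (T := (1 : ℝ)) 2 n,
    coeFn_fourierLp (T := (1 : ℝ)) 2 (n + k)] with x h1 h2 h3 h4
  rw [h1, h2, h3, h4, fourier_add, mul_comm]

theorem rotOp_apply (α : ℝ) (n : ℤ) :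
    rotOp α (fourierLp 2 n) =
      Complex.exp (2 * Real.pi * I * n * α) • (fourierLp 2 n : L2T) := by
  refine Lp.ext ?_
  have hq := (measurePreserving_add_right (AddCircle.haarAddCircle (T := (1 : ℝ)))
    (α : AddCircle (1 : ℝ))).quasiMeasurePreserving.ae_eq
      (coeFn_fourierLp (T := (1 : ℝ)) 2 n)
  filter_upwards [rotOp_coeFn α (fourierLp 2 n), hq, coeFn_fourierLp (T := (1 : ℝ)) 2 n,
    Lp.coeFn_smul (Complex.exp (2 * Real.pi * I * n * α)) (fourierLp 2 n : L2T)]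
    with x h1 h2 h3 h4
  simp only [Function.comp_apply] at h2
  rw [h1, h2, h4, Pi.smul_apply, h3, smul_eq_mul]
  induction x using QuotientAddGroup.induction_on with
  | H x =>
    change fourier n (((x : ℝ) : AddCircle (1 : ℝ)) + _) = _ * fourier n ((x : ℝ) : AddCircle (1 : ℝ))
    rw [← AddCircle.coe_add, fourier_coe_apply, fourier_coe_apply, ← Complex.exp_add]
    congr 1
    push_cast
    ring

theorem star_rotOp_apply (α : ℝ) (n : ℤ) :
    star (rotOp α) (fourierLp 2 n) =
      Complex.exp (-(2 * Real.pi * I * n * α)) • (fourierLp 2 n : L2T) := by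
  have h : star (rotOp α) (rotOp α (fourierLp 2 n)) = (fourierLp 2 n : L2T) := by
    refine ext_inner_left ℂ fun v => ?_
    rw [ContinuousLinearMap.star_eq_adjoint, ContinuousLinearMap.adjoint_inner_right]
    exact LinearIsometry.inner_map_map _ _ _
  rw [rotOp_apply, map_smul] at h
  conv_rhs => rw [← h]
  rw [smul_smul, ← Complex.exp_add, neg_add_cancel, Complex.exp_zero, one_smul]

/-- `cosPos` is multiplication by `cos (2 π x)`. -/
theorem cosPos_coeFn (f : L2T) :
    cosPos f =ᵐ[AddCircle.haarAddCircle]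
      fun x => ((fourier 1 x : ℂ).re : ℂ) * f x := by
  have h0 : cosPos = (2⁻¹ : ℂ) • (mulOp (fourierLp ∞ 1) + mulOp (fourierLp ∞ (-1))) := by
    rw [cosPos, realPart_apply_coe, star_mulOp, ← Complex.coe_smul]
    push_cast
    rfl
  rw [h0]
  filter_upwards [mulOp_coeFn (fourierLp ∞ (-1)) f, mulOp_coeFn (fourierLp ∞ 1) f,
    coeFn_fourierLp (T := (1 : ℝ)) ∞ (-1), coeFn_fourierLp (T := (1 : ℝ)) ∞ 1,
    Lp.coeFn_smul (2⁻¹ : ℂ) (mulOp (fourierLp ∞ 1) f + mulOp (fourierLp ∞ (-1)) f),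
    Lp.coeFn_add (mulOp (fourierLp ∞ 1) f) (mulOp (fourierLp ∞ (-1)) f)] with x h1 h2 h3 h4 h5 h6
  refine h5.trans ?_
  rw [Pi.smul_apply, h6, Pi.add_apply, h1, h2, h3, h4, fourier_neg, Complex.re_eq_add_conj,
    smul_eq_mul]
  ring

/-- `cosMom α θ` is the Fourier multiplier with symbol `cos (2 π (n α + θ))`. -/
theorem cosMom_apply (α θ : ℝ) (n : ℤ) :
    cosMom α θ (fourierLp 2 n) =
      (Real.cos (2 * Real.pi * (n * α + θ)) : ℂ) • (fourierLp 2 n : L2T) := by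
  have h0 : cosMom α θ = (2⁻¹ : ℂ) • (Complex.exp (2 * Real.pi * I * θ) • rotOp α +
      Complex.exp (-(2 * Real.pi * I * θ)) • star (rotOp α)) := by
    rw [cosMom, realPart_apply_coe, star_smul, ← Complex.coe_smul]
    have : star (Complex.exp (2 * Real.pi * I * θ)) = Complex.exp (-(2 * Real.pi * I * θ)) := by
      change (starRingEnd ℂ) _ = _
      rw [← Complex.exp_conj]
      simp [Complex.conj_ofNat]
    rw [this]
    push_cast
    rfl
  rw [h0]
  change (2⁻¹ : ℂ) • (Complex.exp (2 * Real.pi * I * θ) • rotOp α (fourierLp 2 n) +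
      Complex.exp (-(2 * Real.pi * I * θ)) • star (rotOp α) (fourierLp 2 n)) = _
  rw [rotOp_apply, star_rotOp_apply, smul_smul, smul_smul, ← add_smul, smul_smul,
    ← Complex.exp_add, ← Complex.exp_add]
  congr 1
  rw [Complex.ofReal_cos, Complex.cos]
  push_cast
  ring_nf

/-- The defining formula of the almost Mathieu operator on the Fourier basis. -/
theorem harperH_apply (α lam θ : ℝ) (n : ℤ) :
    harperH α lam θ (fourierLp 2 n) =
      fourierLp 2 (n + 1) + fourierLp 2 (n - 1) +
        (2 * lam * Real.cos (2 * Real.pi * (n * α + θ)) : ℂ) • (fourierLp 2 n : L2T) := by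
  have h0 : (2 : ℂ) • cosPos = mulOp (fourierLp ∞ 1) + mulOp (fourierLp ∞ (-1)) := by
    rw [cosPos, realPart_apply_coe, star_mulOp, ← Complex.coe_smul, smul_smul]
    norm_num
  rw [harperH, h0]
  change mulOp (fourierLp ∞ 1) (fourierLp 2 n) + mulOp (fourierLp ∞ (-1)) (fourierLp 2 n) +
    (2 * lam : ℂ) • cosMom α θ (fourierLp 2 n) = _
  rw [mulOp_apply, mulOp_apply, cosMom_apply, smul_smul, sub_eq_add_neg]

/-! ### Mother operators in `A_α` -/

/-- The mother operator of the unitary Harper operators. -/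
def motherUnitaryHarper (κ α lam : ℝ) : UniversalAlgebra α :=
  NormedSpace.exp ((-2 * I * κ) • (realPart (univV α) : UniversalAlgebra α) +
    (-2 * I * κ * lam) • (realPart (univU α) : UniversalAlgebra α))

/-- The mother operator of the kicked Harper operators. -/
def motherKickedHarper (κ α lam : ℝ) : UniversalAlgebra α :=
  NormedSpace.exp ((-2 * I * κ) • (realPart (univV α) : UniversalAlgebra α)) *
    NormedSpace.exp ((-2 * I * κ * lam) • (realPart (univU α) : UniversalAlgebra α))

/-! ### The matrices -/

/-- The unitary discrete Fourier transform matrix `F`, with entries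
`q^(-1/2) exp (2 π i j k / q)`, `0 ≤ j, k < q`. -/
def dft (q : ℕ) : Matrix (Fin q) (Fin q) ℂ :=
  Matrix.of fun j k => (Real.sqrt q : ℂ)⁻¹ * Complex.exp (2 * Real.pi * I / q) ^ (j.1 * k.1)

/-- `G(k, y)`, the diagonal matrix with entries `cos (2 π (y + k j / q))`, `0 ≤ j < q`. -/
def cosDiag (q : ℕ) (k : ℤ) (y : ℝ) : Matrix (Fin q) (Fin q) ℂ :=
  Matrix.diagonal fun j => (Real.cos (2 * Real.pi * (y + k * j.1 / q)) : ℂ)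

/-- The matrix `M_{U_H}(κ, p/q, λ, x, θ)`. -/
def harperMatrix (κ : ℝ) (p : ℤ) (q : ℕ) (lam x θ : ℝ) : Matrix (Fin q) (Fin q) ℂ :=
  NormedSpace.exp
    ((-2 * I * κ) • (cosDiag q 1 x + (lam : ℂ) • (dft q * cosDiag q p θ * (dft q)⁻¹)))

/-- The matrix `M_{U_kH}(κ, p/q, λ, x, θ)`. -/
def kickedMatrix (κ : ℝ) (p : ℤ) (q : ℕ) (lam x θ : ℝ) : Matrix (Fin q) (Fin q) ℂ :=
  NormedSpace.exp ((-2 * I * κ) • cosDiag q 1 x) * dft q *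
    NormedSpace.exp ((-2 * I * κ * lam) • cosDiag q p θ) * (dft q)⁻¹

/-- The numbers `exp (-2 i s cos (2 π (y + k j / q)))`, `0 ≤ j < q`. -/
def kickPhase (q : ℕ) (s : ℝ) (k : ℤ) (y : ℝ) (j : Fin q) : ℂ :=
  Complex.exp (-2 * I * s * Real.cos (2 * Real.pi * (y + k * j.1 / q)))

/-- The circulant matrix with first row `v`; each row is the previous one shifted cyclically one
place to the right. -/
def rowCirculant {q : ℕ} [NeZero q] (v : Fin q → ℂ) : Matrix (Fin q) (Fin q) ℂ :=
  Matrix.of fun j k => v (k - j)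

/-- The first row `q^(-1/2) F (exp (-2 i κ cos (2 π (x + j / q))))_j`. -/
def firstRow (q : ℕ) (κ x : ℝ) : Fin q → ℂ :=
  (Real.sqrt q : ℂ)⁻¹ • (dft q).mulVec (kickPhase q κ 1 x)

/-- Unitary equivalence of square matrices. -/
def UnitarilyEquivalent {q : ℕ} (A B : Matrix (Fin q) (Fin q) ℂ) : Prop :=
  ∃ O ∈ Matrix.unitaryGroup (Fin q) ℂ, A = O * B * O⁻¹

/-! ### Uniform grids -/

/-- The uniform grid of `N` points in `[0, 1/q)` with spacing `1 / (N q)` and first point `x₀`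
(where `0 ≤ x₀ < 1 / (N q)`). -/
def grid (q N : ℕ) (x₀ : ℝ) : Set ℝ := {x | ∃ j : ℕ, j < N ∧ x = x₀ + j / (N * q)}

/-- The estimate of a spectrum obtained from matrices `M x`, with `x` in an `N`-point grid. -/
def gridSpectrum {q : ℕ} (N : ℕ) (x₀ : ℝ) (M : ℝ → Matrix (Fin q) (Fin q) ℂ) : Set ℂ :=
  ⋃ x ∈ grid q N x₀, spectrum ℂ (M x)

/-- The estimate of a spectrum obtained from matrices `M x θ`, with `(x, θ)` in an `N × N` grid. -/
def gridSpectrum₂ {q : ℕ} (N : ℕ) (x₀ θ₀ : ℝ) (M : ℝ → ℝ → Matrix (Fin q) (Fin q) ℂ) : Set ℂ :=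
  ⋃ x ∈ grid q N x₀, ⋃ θ ∈ grid q N θ₀, spectrum ℂ (M x θ)

end Harper

end

open Harper

/-!
For `α = p / q` the powers `U ^ q` and `V ^ q` of the generators of the rotation algebra `A_α` are
central, and `A_α` is spanned by the words `U ^ i V ^ j` over the central `C*`-algebra `Z` that they
generate. For all real `x`, `θ` there is a representation `matrixRep p q x θ` of `A_α` by `q × q`
matrices that maps the mother operators to `M_{U_H}(x, θ)` and `M_{U_kH}(x, θ)`; another
representation, `l2Rep α θ` on `L²(𝕋)`, maps them to `U_H(θ)` and `U_kH(θ)`. All spectra are compared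
through the kernels of these representations.

* For a normal element `a`, an inclusion of kernels gives an inclusion of the spectra of the images
  of `a`, since a continuous function of `a` is killed exactly when it vanishes on the spectrum of
  the image (`spectrum_subset_closure_iUnion`).
* An inclusion of kernels can be tested on `Z` (`forall_apply_eq_zero_of_powerAlgebra`): averaging
  over conjugation by the words `U ^ j V ^ k`, `j, k < q`, maps `A_α` to `Z`, maps the kernel of every
  homomorphism to itself, and is faithful on positive elements.
* On `Z` the representation `matrixRep p q x θ` is scalar: it is the character with the values
  `e(q θ)` at `U ^ q` and `e(q x)` at `V ^ q` (`matrixRep_eq_character`). By Gelfand duality an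
  element of a commutative `C*`-algebra is determined by its characters, so the kernel of any
  representation `π` is the intersection of the kernels of those `matrixRep p q x θ` whose character
  occurs on `π(Z)`.

For the identity of `A_α` all characters occur. For `l2Rep α θ` those with the given `θ` occur: `U ^ q`
is the scalar `e(q θ)`, and `V ^ q` is multiplication by `ξ_q`, whose spectrum is the whole circle
because conjugation by rotations rotates it (`mem_spectrum_posOp_pow`). Two matrix representations
whose parameters agree modulo `1 / q` coincide on `Z`, so they have the same kernel, and the spectra of
the matrices have period `1 / q` in `x` and `θ` (`spectrum_matrixRep_eq`). As the matrices depend continuously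
on the parameters, the unions over a period are closed, which gives the formulas for the spectra.

For the grids, the matrices are Lipschitz in the parameters, since the exponential is a contraction on
skew-adjoint elements (`norm_exp_sub_exp_le`), and the spectrum of a matrix lies within `‖A - B‖` of
the spectrum of a normal matrix `B` (`exists_mem_spectrum_dist_le`). Every point is, modulo `1 / q`,
within half a step of the grid (`exists_mem_grid`), whence the constants.
-/

section

open Harper RotationAlgebra
open scoped CStarAlgebra Matrix.Norms.L2Operator ENNReal Pointwise

/-! ### Spectra, exponentials and characters in `C*`-algebras -/

/-- If the kernels of the `f i` jointly lie in the kernel of `g`, then the spectrum of `g a`, `a`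
normal, is approximated by the spectra of the `f i a`: a function of `a` that vanishes on all of
the latter is killed by every `f i`, hence by `g`. -/
theorem spectrum_subset_closure_iUnion {ι : Type*} {A C : Type*} {B : ι → Type*} [CStarAlgebra A]
    [CStarAlgebra C] [∀ i, CStarAlgebra (B i)] (f : ∀ i, A →⋆ₐ[ℂ] B i) (g : A →⋆ₐ[ℂ] C)
    (h : ∀ a, (∀ i, f i a = 0) → g a = 0) (a : A) (ha : IsStarNormal a) :
    spectrum ℂ (g a) ⊆ closure (⋃ i, spectrum ℂ (f i a)) := by
  intro z hz
  by_contra hcl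
  obtain ⟨φ, h0, h1, -⟩ := exists_continuous_zero_one_of_isClosed
    (s := closure (⋃ i, spectrum ℂ (f i a))) (t := {z}) isClosed_closure isClosed_singleton
    (Set.disjoint_singleton_right.2 hcl)
  let ψ : ℂ → ℂ := fun w => (φ w : ℂ)
  have hψ : Continuous ψ := by fun_prop
  have hf : ∀ i, f i (cfc ψ a) = 0 := by
    intro i
    have : IsStarNormal (f i a) := ha.map (f i)
    rw [(f i).map_cfc ψ a hψ.continuousOn (map_continuous _)]
    rw [cfc_congr (g := fun _ => 0), cfc_const_zero]
    intro w hw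
    have := h0 (subset_closure (Set.mem_iUnion.2 ⟨i, hw⟩))
    simp only [ψ, this]
    simp
  have hg := h _ hf
  have hn : IsStarNormal (g a) := ha.map g
  rw [g.map_cfc ψ a hψ.continuousOn (map_continuous _)] at hg
  have hmem : (1 : ℂ) ∈ spectrum ℂ (cfc ψ (g a)) := by
    rw [cfc_map_spectrum ψ (g a) hn hψ.continuousOn]
    refine ⟨z, hz, ?_⟩
    have := h1 (Set.mem_singleton z)
    simp only [ψ, this]
    simp
  have : Nontrivial C := by
    by_contra hC
    have := not_nontrivial_iff_subsingleton.1 hC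
    simp [spectrum.of_subsingleton] at hz
  rw [hg, spectrum.zero_eq] at hmem
  simp at hmem

theorem spectrum_subset_of_ker {A B C : Type*} [CStarAlgebra A] [CStarAlgebra B] [CStarAlgebra C]
    (f : A →⋆ₐ[ℂ] B) (g : A →⋆ₐ[ℂ] C) (h : ∀ a, f a = 0 → g a = 0) {a : A} (ha : IsStarNormal a) :
    spectrum ℂ (g a) ⊆ spectrum ℂ (f a) := by
  have := spectrum_subset_closure_iUnion (fun _ : Unit => f) g (fun b hb => h b (hb ())) a ha
  rwa [Set.iUnion_const, (spectrum.isClosed _).closure_eq] at this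

/-- The spectrum of an element of a `C*`-algebra lies within `‖a - b‖` of the spectrum of a normal
element `b`. -/
theorem exists_mem_spectrum_dist_le {A : Type*} [CStarAlgebra A] {a b : A} (hb : IsStarNormal b)
    {z : ℂ} (hz : z ∈ spectrum ℂ a) : ∃ w ∈ spectrum ℂ b, dist z w ≤ ‖a - b‖ := by
  by_contra! hcon
  have : Nontrivial A := by
    by_contra hC
    have := not_nontrivial_iff_subsingleton.1 hC
    simp [spectrum.of_subsingleton] at hz
  have hne : ∀ w ∈ spectrum ℂ b, z - w ≠ 0 := fun w hw h0 => by
    have := hcon w hw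
    rw [dist_eq_norm, h0, norm_zero] at this
    exact absurd this (norm_nonneg _).not_gt
  have hcont : ContinuousOn (fun w : ℂ => (z - w)⁻¹) (spectrum ℂ b) :=
    ContinuousOn.inv₀ (by fun_prop) hne
  set r := cfc (fun w : ℂ => (z - w)⁻¹) b
  have hzb : cfc (fun w : ℂ => z - w) b = algebraMap ℂ A z - b := by
    rw [cfc_sub (fun _ => z) (fun w => w) b, cfc_const z b, cfc_id' ℂ b]
  have h1 : (algebraMap ℂ A z - b) * r = 1 := by
    rw [← hzb, ← cfc_mul _ _ b (by fun_prop) hcont, ← cfc_one ℂ b]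
    exact cfc_congr fun w hw => mul_inv_cancel₀ (hne w hw)
  have h2 : r * (algebraMap ℂ A z - b) = 1 := by
    rw [← hzb, ← cfc_mul _ _ b hcont (by fun_prop), ← cfc_one ℂ b]
    exact cfc_congr fun w hw => inv_mul_cancel₀ (hne w hw)
  have hlt : ‖r * (b - a)‖ < 1 := by
    rcases eq_or_ne a b with rfl | hab
    · simp
    have hpos : 0 < ‖a - b‖ := norm_pos_iff.2 (sub_ne_zero.2 hab)
    have hr : ‖r‖ < ‖a - b‖⁻¹ := by
      refine norm_cfc_lt (by positivity) fun w hw => ?_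
      rw [norm_inv, ← dist_eq_norm]
      exact inv_strictAnti₀ hpos (hcon w hw)
    calc ‖r * (b - a)‖ ≤ ‖r‖ * ‖b - a‖ := norm_mul_le _ _
      _ = ‖r‖ * ‖a - b‖ := by rw [norm_sub_rev]
      _ < ‖a - b‖⁻¹ * ‖a - b‖ := by gcongr
      _ = 1 := inv_mul_cancel₀ hpos.ne'
  -- `z - a = (z - b) (1 + (z - b)⁻¹ (b - a))`, a product of two units
  have hu : IsUnit (1 - -(r * (b - a))) := isUnit_one_sub_of_norm_lt_one (by rwa [norm_neg])
  have hub : IsUnit (algebraMap ℂ A z - b) := ⟨⟨_, r, h1, h2⟩, rfl⟩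
  have key : algebraMap ℂ A z - a = (algebraMap ℂ A z - b) * (1 - -(r * (b - a))) := by
    rw [sub_neg_eq_add, mul_add, mul_one, ← mul_assoc, h1, one_mul]
    abel
  exact hz (by rw [spectrum.mem_resolventSet_iff, key]; exact hub.mul hu)

theorem star_smul_of_star_eq_neg {A : Type*} [CStarAlgebra A] {a : A} (ha : IsSelfAdjoint a)
    {c : ℂ} (hc : star c = -c) : star (c • a) = -(c • a) := by
  rw [star_smul, ha.star_eq, hc, neg_smul]

theorem exp_smul_mem_unitary {A : Type*} [CStarAlgebra A] {a : A} (ha : IsSelfAdjoint a) {c : ℂ}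
    (hc : star c = -c) : NormedSpace.exp (c • a) ∈ unitary A := by
  let +nondep : NormedAlgebra ℚ A := .restrictScalars ℚ ℂ A
  refine NormedSpace.exp_mem_unitary_of_mem_skewAdjoint ?_
  rw [skewAdjoint.mem_iff, star_smul_of_star_eq_neg ha hc]

/-- The exponential is a contraction on skew-adjoint elements: the path
`exp (t a) exp ((1 - t) b)` from `exp b` to `exp a` has speed at most `‖a - b‖`. -/
theorem norm_exp_sub_exp_le {A : Type*} [CStarAlgebra A] {a b : A} (ha : star a = -a)
    (hb : star b = -b) : ‖NormedSpace.exp a - NormedSpace.exp b‖ ≤ ‖a - b‖ := by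
  rcases subsingleton_or_nontrivial A with hA | hA
  · simp [Subsingleton.elim (NormedSpace.exp a) (NormedSpace.exp b)]
  have hun : ∀ (c : A), star c = -c → ∀ t : ℝ, ‖NormedSpace.exp (t • c)‖ = 1 := by
    intro c hc t
    let +nondep : NormedAlgebra ℚ A := .restrictScalars ℚ ℂ A
    refine CStarRing.norm_of_mem_unitary (NormedSpace.exp_mem_unitary_of_mem_skewAdjoint ?_)
    rw [skewAdjoint.mem_iff, star_smul, hc, smul_neg, star_trivial]
  let γ : ℝ → A := fun t => NormedSpace.exp (t • a) * NormedSpace.exp ((1 - t) • b)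
  have hderiv : ∀ t : ℝ, HasDerivAt γ
      (NormedSpace.exp (t • a) * (a - b) * NormedSpace.exp ((1 - t) • b)) t := by
    intro t
    have h1 := hasDerivAt_exp_smul_const (𝕂 := ℝ) a t
    have h2 := (hasDerivAt_exp_smul_const' (𝕂 := ℝ) b (1 - t)).scomp t
      ((hasDerivAt_id t).const_sub 1)
    refine (h1.mul h2).congr_deriv ?_
    simp only [Function.comp_apply, neg_smul, one_smul]
    noncomm_ring
  have := norm_image_sub_le_of_norm_deriv_le_segment_01' (f := γ)
    (f' := fun t => NormedSpace.exp (t • a) * (a - b) * NormedSpace.exp ((1 - t) • b))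
    (C := ‖a - b‖) (fun t _ => (hderiv t).hasDerivWithinAt) (fun t _ => by
      calc _ ≤ ‖NormedSpace.exp (t • a)‖ * ‖a - b‖ * ‖NormedSpace.exp ((1 - t) • b)‖ :=
            (norm_mul_le _ _).trans (by gcongr; exact norm_mul_le _ _)
        _ = ‖a - b‖ := by rw [hun a ha, hun b hb]; ring)
  simpa [γ, NormedSpace.exp_zero] using this

theorem norm_mul_sub_mul_le {A : Type*} [CStarAlgebra A] {u v w z : A} (hw : w ∈ unitary A)
    (hv : v ∈ unitary A) : ‖u * w - v * z‖ ≤ ‖u - v‖ + ‖w - z‖ := by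
  have : u * w - v * z = (u - v) * w + v * (w - z) := by noncomm_ring
  rw [this]
  refine (norm_add_le _ _).trans_eq ?_
  rw [CStarRing.norm_mul_mem_unitary _ hw, CStarRing.norm_mem_unitary_mul _ hv]

theorem StarAlgHom.map_normedSpace_exp {A B : Type*} [CStarAlgebra A] [CStarAlgebra B]
    (f : A →⋆ₐ[ℂ] B) (a : A) : f (NormedSpace.exp a) = NormedSpace.exp (f a) := by
  let +nondep : NormedAlgebra ℚ A := .restrictScalars ℚ ℂ A
  let +nondep : Algebra ℚ B := .compHom _ (algebraMap ℚ ℂ)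
  exact NormedSpace.map_exp f (map_continuous f) a

/-- The union of the spectra of a continuous family of elements over a compact space is closed. -/
theorem isClosed_iUnion_spectrum {K A : Type*} [TopologicalSpace K] [CompactSpace K]
    [CStarAlgebra A] {f : K → A} (hf : Continuous f) : IsClosed (⋃ k, spectrum ℂ (f k)) := by
  have h : IsClosed {y : K × ℂ | algebraMap ℂ A y.2 - f y.1 ∈ nonunits A} :=
    nonunits.isClosed.preimage (by fun_prop)
  convert isClosedMap_snd_of_compactSpace _ h using 1
  ext z
  simp only [Set.mem_iUnion, Set.mem_image, Set.mem_ofPred_eq, Prod.exists, exists_eq_right]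
  rfl

section Characters

variable {A : Type*} [CStarAlgebra A] {S : StarSubalgebra ℂ A}

/-- A closed commutative star subalgebra of a `C*`-algebra is a commutative `C*`-algebra. -/
noncomputable abbrev commCStarAlgebraOfComm (hS : IsClosed (S : Set A))
    (hc : ∀ x ∈ S, ∀ y ∈ S, x * y = y * x) : CommCStarAlgebra S where
  toCStarAlgebra := inferInstanceAs (CStarAlgebra S)
  mul_comm x y := Subtype.ext (hc x x.2 y y.2)

theorem eq_zero_of_forall_character (hS : IsClosed (S : Set A))
    (hc : ∀ x ∈ S, ∀ y ∈ S, x * y = y * x) (y : S) (h : ∀ χ : S →⋆ₐ[ℂ] ℂ, χ y = 0) : y = 0 := by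
  let := commCStarAlgebraOfComm hS hc
  refine (gelfandTransform_isometry S).injective ?_
  rw [map_zero]
  ext χ
  exact h { AlgHomClass.toAlgHom χ with map_star' := map_star χ }

theorem exists_character_apply_eq (hS : IsClosed (S : Set A))
    (hc : ∀ x ∈ S, ∀ y ∈ S, x * y = y * x) (y : S) {z : ℂ} (hz : z ∈ spectrum ℂ (y : A)) :
    ∃ χ : S →⋆ₐ[ℂ] ℂ, χ y = z := by
  rw [← StarSubalgebra.spectrum_eq (hS := hS)] at hz
  let := commCStarAlgebraOfComm hS hc
  obtain ⟨χ, hχ⟩ := WeakDual.CharacterSpace.mem_spectrum_iff_exists.1 hz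
  exact ⟨{ AlgHomClass.toAlgHom χ with map_star' := map_star χ }, hχ⟩

end Characters

/-! ### Averaging in the algebra of a rational frame -/

namespace RotationAlgebra.IsFrame

variable {A : Type*} [CStarAlgebra A] {α : ℝ} {U V : A}

/-- The commutation phase `exp (2 π i α)` of a frame. -/
noncomputable def phase (α : ℝ) : ℂ := Complex.exp (2 * Real.pi * Complex.I * α)

theorem phase_ne_zero (α : ℝ) : phase α ≠ 0 := Complex.exp_ne_zero _

theorem comm_phase (h : IsFrame α U V) : U * V = phase α • (V * U) := h.comm

theorem swap (h : IsFrame α U V) : V * U = (phase α)⁻¹ • (U * V) := by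
  rw [h.comm_phase, smul_smul, inv_mul_cancel₀ (phase_ne_zero α), one_smul]

theorem left_mul_pow (h : IsFrame α U V) (j : ℕ) : U * V ^ j = phase α ^ j • (V ^ j * U) := by
  induction j with
  | zero => simp
  | succ j ih =>
    rw [pow_succ, ← mul_assoc, ih, smul_mul_assoc, mul_assoc, h.comm_phase, mul_smul_comm,
      smul_smul, mul_assoc, pow_succ]

theorem right_mul_pow (h : IsFrame α U V) (i : ℕ) :
    V * U ^ i = (phase α)⁻¹ ^ i • (U ^ i * V) := by
  induction i with
  | zero => simp
  | succ i ih =>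
    rw [pow_succ, ← mul_assoc, ih, smul_mul_assoc, mul_assoc, h.swap, mul_smul_comm,
      smul_smul, mul_assoc, pow_succ]

theorem left_mul_word (h : IsFrame α U V) (i j : ℕ) :
    U * (U ^ i * V ^ j) = phase α ^ j • (U ^ i * V ^ j * U) := by
  rw [← mul_assoc, (Commute.self_pow U i).eq, mul_assoc, h.left_mul_pow, mul_smul_comm, mul_assoc]

theorem right_mul_word (h : IsFrame α U V) (i j : ℕ) :
    V * (U ^ i * V ^ j) = (phase α)⁻¹ ^ i • (U ^ i * V ^ j * V) := by
  rw [← mul_assoc, h.right_mul_pow, smul_mul_assoc, mul_assoc, (Commute.self_pow V j).eq, mul_assoc]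

theorem star_mul_left (h : IsFrame α U V) : star U * U = 1 := (Unitary.mem_iff.1 h.unitary_left).1

theorem left_mul_star (h : IsFrame α U V) : U * star U = 1 := (Unitary.mem_iff.1 h.unitary_left).2

theorem star_mul_right (h : IsFrame α U V) : star V * V = 1 :=
  (Unitary.mem_iff.1 h.unitary_right).1

theorem right_mul_star (h : IsFrame α U V) : V * star V = 1 :=
  (Unitary.mem_iff.1 h.unitary_right).2

end RotationAlgebra.IsFrame

namespace RotationAlgebra

open IsFrame

variable {A : Type*} [CStarAlgebra A] {α : ℝ} {U V : A}

theorem commute_star_of_mem_unitary {u a : A} (hu : u ∈ unitary A) (h : Commute u a) :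
    Commute (star u) a := by
  have h1 := (Unitary.mem_iff.1 hu).1
  have h2 := (Unitary.mem_iff.1 hu).2
  calc star u * a = star u * a * (u * star u) := by rw [h2, mul_one]
    _ = star u * (a * u) * star u := by noncomm_ring
    _ = star u * (u * a) * star u := by rw [h.eq]
    _ = (star u * u) * a * star u := by noncomm_ring
    _ = a * star u := by rw [h1, one_mul]

/-- The `C*`-algebra generated by `U ^ q` and `V ^ q`; it is central in the algebra generated by
`U` and `V` if `(U, V)` is a frame whose parameter has denominator `q`. -/
def powerAlgebra (q : ℕ) (U V : A) : StarSubalgebra ℂ A :=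
  (StarAlgebra.adjoin ℂ {U ^ q, V ^ q}).topologicalClosure

theorem isClosed_powerAlgebra (q : ℕ) (U V : A) : IsClosed (powerAlgebra q U V : Set A) :=
  StarSubalgebra.isClosed_topologicalClosure _

theorem left_pow_mem (q : ℕ) (U V : A) : U ^ q ∈ powerAlgebra q U V :=
  StarSubalgebra.le_topologicalClosure _ (StarAlgebra.subset_adjoin ℂ _ (by simp))

theorem right_pow_mem (q : ℕ) (U V : A) : V ^ q ∈ powerAlgebra q U V :=
  StarSubalgebra.le_topologicalClosure _ (StarAlgebra.subset_adjoin ℂ _ (by simp))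

theorem powerAlgebra_le {q : ℕ} {S : StarSubalgebra ℂ A} (hS : IsClosed (S : Set A))
    (hU : U ^ q ∈ S) (hV : V ^ q ∈ S) : powerAlgebra q U V ≤ S := by
  refine StarSubalgebra.topologicalClosure_minimal (StarAlgebra.adjoin_le ?_) hS
  rintro x (rfl | rfl)
  exacts [hU, hV]

theorem isClosed_centralizer (s : Set A) :
    IsClosed (StarSubalgebra.centralizer ℂ s : Set A) := by
  rw [StarSubalgebra.coe_centralizer]
  exact Set.isClosed_centralizer _

theorem mem_centralizer_pair (hU : U ∈ unitary A) (hV : V ∈ unitary A) {a : A}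
    (h1 : Commute U a) (h2 : Commute V a) : a ∈ StarSubalgebra.centralizer ℂ {U, V} := by
  rw [StarSubalgebra.mem_centralizer_iff]
  rintro g (rfl | rfl)
  exacts [⟨h1.eq, (commute_star_of_mem_unitary hU h1).eq⟩,
    ⟨h2.eq, (commute_star_of_mem_unitary hV h2).eq⟩]

theorem powerAlgebra_le_centralizer {q : ℕ} (h : IsFrame α U V) (hα : phase α ^ q = 1) :
    powerAlgebra q U V ≤ StarSubalgebra.centralizer ℂ {U, V} := by
  refine powerAlgebra_le (isClosed_centralizer _) ?_ ?_
  · refine mem_centralizer_pair h.unitary_left h.unitary_right (Commute.self_pow U q) ?_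
    rw [commute_iff_eq, h.right_mul_pow, inv_pow, hα, inv_one, one_smul]
  · refine mem_centralizer_pair h.unitary_left h.unitary_right ?_ (Commute.self_pow V q)
    rw [commute_iff_eq, h.left_mul_pow, hα, one_smul]

theorem commute_left_of_mem {q : ℕ} (h : IsFrame α U V) (hα : phase α ^ q = 1) {z : A}
    (hz : z ∈ powerAlgebra q U V) : Commute U z :=
  ((StarSubalgebra.mem_centralizer_iff _).1 (powerAlgebra_le_centralizer h hα hz) U (by simp)).1

theorem commute_right_of_mem {q : ℕ} (h : IsFrame α U V) (hα : phase α ^ q = 1) {z : A}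
    (hz : z ∈ powerAlgebra q U V) : Commute V z :=
  ((StarSubalgebra.mem_centralizer_iff _).1 (powerAlgebra_le_centralizer h hα hz) V (by simp)).1

theorem powerAlgebra_comm {q : ℕ} (h : IsFrame α U V) (hα : phase α ^ q = 1) :
    ∀ x ∈ powerAlgebra q U V, ∀ y ∈ powerAlgebra q U V, x * y = y * x := by
  intro x hx y hy
  have key : powerAlgebra q U V ≤ StarSubalgebra.centralizer ℂ (powerAlgebra q U V : Set A) := by
    refine powerAlgebra_le (isClosed_centralizer _) ?_ ?_ <;>
    · rw [StarSubalgebra.mem_centralizer_iff]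
      intro g hg
      first
      | exact ⟨((commute_left_of_mem h hα hg).pow_left q).eq.symm,
          ((commute_left_of_mem h hα (star_mem hg)).pow_left q).eq.symm⟩
      | exact ⟨((commute_right_of_mem h hα hg).pow_left q).eq.symm,
          ((commute_right_of_mem h hα (star_mem hg)).pow_left q).eq.symm⟩
  exact ((StarSubalgebra.mem_centralizer_iff _).1 (key hy) x hx).1

/-- Conjugation-averaging over the words `U ^ j V ^ k`, `j, k < q`: up to the factor `q ^ 2`, the
conditional expectation onto `powerAlgebra q U V`. -/
noncomputable def average (q : ℕ) (U V : A) (a : A) : A :=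
  ∑ j ∈ Finset.range q, ∑ k ∈ Finset.range q,
    U ^ j * (V ^ k * a * star V ^ k) * star U ^ j

theorem conj_pow_of_smul {u w : A} {d : ℂ} (hu : u * star u = 1) (h : u * w = d • (w * u)) (k : ℕ) :
    u ^ k * w * star u ^ k = d ^ k • w := by
  induction k with
  | zero => simp
  | succ k ih =>
    calc u ^ (k + 1) * w * star u ^ (k + 1) = u ^ k * (u * w) * (star u * star u ^ k) := by
          rw [pow_succ, pow_succ']; noncomm_ring
      _ = d • (u ^ k * w * (u * star u) * star u ^ k) := by
          rw [h]; simp only [mul_smul_comm, smul_mul_assoc, mul_assoc]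
      _ = d ^ (k + 1) • w := by rw [hu, mul_one, ih, smul_smul, pow_succ']

/-- The words `U ^ i V ^ j` are eigenvectors of the averaging map, since conjugation by `U` or `V`
multiplies them by phases. -/
theorem average_word {q : ℕ} (h : IsFrame α U V) (i j : ℕ) :
    average q U V (U ^ i * V ^ j) = ((∑ m ∈ Finset.range q, (phase α ^ j) ^ m) *
      ∑ k ∈ Finset.range q, ((phase α)⁻¹ ^ i) ^ k) • (U ^ i * V ^ j) := by
  simp only [average, conj_pow_of_smul h.right_mul_star (h.right_mul_word i j), mul_smul_comm,
    smul_mul_assoc, conj_pow_of_smul h.left_mul_star (h.left_mul_word i j), smul_smul]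
  rw [Finset.sum_mul_sum, Finset.sum_smul]
  refine Finset.sum_congr rfl fun m _ => ?_
  rw [Finset.sum_smul]
  exact Finset.sum_congr rfl fun k _ => by rw [mul_comm]

theorem average_mul_of_mem {q : ℕ} (h : IsFrame α U V) (hα : phase α ^ q = 1) {z : A}
    (hz : z ∈ powerAlgebra q U V) (a : A) :
    average q U V (z * a) = z * average q U V a := by
  simp only [average, Finset.mul_sum]
  refine Finset.sum_congr rfl fun j _ => Finset.sum_congr rfl fun k _ => ?_
  have h1 := (((commute_left_of_mem h hα hz).pow_left j).eq).symm
  have h2 := (((commute_right_of_mem h hα hz).pow_left k).eq).symm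
  calc U ^ j * (V ^ k * (z * a) * star V ^ k) * star U ^ j
      = U ^ j * ((V ^ k * z) * a * star V ^ k) * star U ^ j := by noncomm_ring
    _ = (U ^ j * z) * (V ^ k * a * star V ^ k) * star U ^ j := by rw [← h2]; noncomm_ring
    _ = _ := by rw [← h1]; noncomm_ring

/-- The geometric sums in the eigenvalue of `U ^ i V ^ j` vanish unless `q` divides `i` and `j`. -/
theorem average_word_mem {q : ℕ} (h : IsFrame α U V) (hα : IsPrimitiveRoot (phase α) q)
    (i j : ℕ) : average q U V (U ^ i * V ^ j) ∈ powerAlgebra q U V := by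
  rw [average_word h]
  have geom : ∀ {d : ℂ}, d ^ q = 1 → d ≠ 1 → ∑ m ∈ Finset.range q, d ^ m = 0 := by
    intro d hd h1
    have := geom_sum_mul d q
    rw [hd, sub_self, mul_eq_zero] at this
    exact this.resolve_right (sub_ne_zero.2 h1)
  by_cases hj : q ∣ j
  · by_cases hi : q ∣ i
    · obtain ⟨i, rfl⟩ := hi
      obtain ⟨j, rfl⟩ := hj
      rw [pow_mul U, pow_mul V]
      exact (powerAlgebra q U V).smul_mem
        (mul_mem (pow_mem (left_pow_mem q U V) i) (pow_mem (right_pow_mem q U V) j)) _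
    · rw [geom (d := (phase α)⁻¹ ^ i), mul_zero, zero_smul]
      · exact zero_mem _
      · rw [← pow_mul, mul_comm, pow_mul, inv_pow, hα.pow_eq_one, inv_one, one_pow]
      · exact fun h' => hi (hα.inv.dvd_of_pow_eq_one i h')
  · rw [geom (d := phase α ^ j), zero_mul, zero_smul]
    · exact zero_mem _
    · rw [← pow_mul, mul_comm, pow_mul, hα.pow_eq_one, one_pow]
    · exact fun h' => hj (hα.dvd_of_pow_eq_one j h')

/-- The algebra generated by a frame is spanned by the words `U ^ i V ^ j`, `i, j ∈ ℕ`, over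
`powerAlgebra`; the adjoints are covered by `star U = star (U ^ q) U ^ (q - 1)`. -/
theorem adjoin_le_span_words {q : ℕ} (hq : 0 < q) (h : IsFrame α U V) (hα : phase α ^ q = 1)
    {a : A} (ha : a ∈ StarAlgebra.adjoin ℂ {U, V}) :
    a ∈ Submodule.span ℂ {w : A | ∃ z ∈ powerAlgebra q U V, ∃ i j : ℕ, w = z * (U ^ i * V ^ j)} := by
  set W := Submodule.span ℂ
    {w : A | ∃ z ∈ powerAlgebra q U V, ∃ i j : ℕ, w = z * (U ^ i * V ^ j)} with hW
  have word : ∀ z ∈ powerAlgebra q U V, ∀ i j : ℕ, z * (U ^ i * V ^ j) ∈ W := fun z hz i j =>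
    Submodule.subset_span ⟨z, hz, i, j, rfl⟩
  have zmem : ∀ z ∈ powerAlgebra q U V, ∀ w ∈ W, z * w ∈ W := by
    intro z hz w hw
    induction hw using Submodule.span_induction with
    | mem w hw =>
      obtain ⟨y, hy, i, j, rfl⟩ := hw
      rw [← mul_assoc]
      exact word _ (mul_mem hz hy) i j
    | zero => simp
    | add x y _ _ hx hy => rw [mul_add]; exact add_mem hx hy
    | smul c x _ hx => rw [mul_smul_comm]; exact W.smul_mem c hx
  have hU : ∀ w ∈ W, U * w ∈ W := by
    intro w hw
    induction hw using Submodule.span_induction with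
    | mem w hw =>
      obtain ⟨y, hy, i, j, rfl⟩ := hw
      rw [← mul_assoc, (commute_left_of_mem h hα hy).eq, mul_assoc, ← mul_assoc U, ← pow_succ']
      exact word _ hy _ _
    | zero => simp
    | add x y _ _ hx hy => rw [mul_add]; exact add_mem hx hy
    | smul c x _ hx => rw [mul_smul_comm]; exact W.smul_mem c hx
  have hV : ∀ w ∈ W, V * w ∈ W := by
    intro w hw
    induction hw using Submodule.span_induction with
    | mem w hw =>
      obtain ⟨y, hy, i, j, rfl⟩ := hw
      rw [← mul_assoc, (commute_right_of_mem h hα hy).eq, mul_assoc, h.right_mul_word,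
        mul_smul_comm, mul_assoc (U ^ i), ← pow_succ]
      exact W.smul_mem _ (word _ hy _ _)
    | zero => simp
    | add x y _ _ hx hy => rw [mul_add]; exact add_mem hx hy
    | smul c x _ hx => rw [mul_smul_comm]; exact W.smul_mem c hx
  have pow_mul_mem : ∀ x : A, (∀ w ∈ W, x * w ∈ W) → ∀ n : ℕ, ∀ w ∈ W, x ^ n * w ∈ W := by
    intro x hx n
    induction n with
    | zero => intro w hw; simpa using hw
    | succ n ih => intro w hw; rw [pow_succ', mul_assoc]; exact hx _ (ih w hw)
  have star_eq : ∀ x : A, star x * x = 1 → star x = star (x ^ q) * x ^ (q - 1) := by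
    intro x hx
    obtain ⟨n, rfl⟩ : ∃ n, q = n + 1 := ⟨q - 1, by omega⟩
    have hn : star x ^ n * x ^ n = 1 := by
      induction n with
      | zero => simp
      | succ n ih =>
        rw [pow_succ, pow_succ', mul_assoc, ← mul_assoc (star x) x, hx, one_mul]
        exact pow_mul_pow_eq_one n hx
    rw [star_pow, Nat.add_sub_cancel, pow_succ', mul_assoc, hn, mul_one]
  have hUs : ∀ w ∈ W, star U * w ∈ W := by
    intro w hw
    rw [star_eq U h.star_mul_left, mul_assoc]
    exact zmem _ (star_mem (left_pow_mem q U V)) _ (pow_mul_mem U hU _ w hw)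
  have hVs : ∀ w ∈ W, star V * w ∈ W := by
    intro w hw
    rw [star_eq V h.star_mul_right, mul_assoc]
    exact zmem _ (star_mem (right_pow_mem q U V)) _ (pow_mul_mem V hV _ w hw)
  have hmul : ∀ w ∈ W, a * w ∈ W := by
    rw [← StarSubalgebra.mem_toSubalgebra, StarAlgebra.adjoin_toSubalgebra] at ha
    induction ha using Algebra.adjoin_induction with
    | mem x hx =>
      rcases hx with (rfl | rfl) | hx
      · exact hU
      · exact hV
      · rcases hx with hx | hx
        · rw [← star_star x, hx]; exact hUs
        · rw [← star_star x, Set.mem_singleton_iff.1 hx]; exact hVs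
    | algebraMap r =>
      intro w hw
      rw [← Algebra.smul_def]
      exact W.smul_mem r hw
    | add x y _ _ hx hy => intro w hw; rw [add_mul]; exact add_mem (hx w hw) (hy w hw)
    | mul x y _ _ hx hy => intro w hw; rw [mul_assoc]; exact hx _ (hy w hw)
  have h1 : (1 : A) ∈ W := by simpa using word 1 (one_mem _) 0 0
  simpa using hmul 1 h1

theorem average_mem {q : ℕ} (hq : 0 < q) (h : IsFrame α U V) (hα : IsPrimitiveRoot (phase α) q)
    (hgen : (StarAlgebra.adjoin ℂ {U, V}).topologicalClosure = ⊤) (a : A) :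
    average q U V a ∈ powerAlgebra q U V := by
  have hcont : Continuous (average q U V) := by
    unfold average
    fun_prop
  have hcl : IsClosed {a : A | average q U V a ∈ powerAlgebra q U V} :=
    (isClosed_powerAlgebra q U V).preimage hcont
  have ha : a ∈ (StarAlgebra.adjoin ℂ {U, V}).topologicalClosure := hgen ▸ trivial
  refine closure_minimal (fun b hb => ?_) hcl ha
  replace hb := adjoin_le_span_words hq h hα.pow_eq_one hb
  change average q U V b ∈ powerAlgebra q U V
  induction hb using Submodule.span_induction with
  | mem w hw =>
    obtain ⟨z, hz, i, j, rfl⟩ := hw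
    rw [average_mul_of_mem h hα.pow_eq_one hz]
    exact mul_mem hz (average_word_mem h hα i j)
  | zero => simp [average]
  | add x y _ _ hx hy =>
    have : average q U V (x + y) = average q U V x + average q U V y := by
      simp only [average, mul_add, add_mul, Finset.sum_add_distrib]
    rw [this]
    exact add_mem hx hy
  | smul c x _ hx =>
    have : average q U V (c • x) = c • average q U V x := by
      simp only [average, mul_smul_comm, smul_mul_assoc, Finset.smul_sum]
    rw [this]
    exact (powerAlgebra q U V).smul_mem hx c

/-- An inclusion of kernels of representations of a rational rotation algebra may be tested on the
central subalgebra `powerAlgebra q U V`: averaging `star a * a` lands there, and is faithful, as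
`g (average q U V (star a * a))` is a sum of positive elements one of which is
`star (g a) * g a`. -/
theorem forall_apply_eq_zero_of_powerAlgebra {q : ℕ} (hq : 0 < q) (h : IsFrame α U V)
    (hα : IsPrimitiveRoot (phase α) q)
    (hgen : (StarAlgebra.adjoin ℂ {U, V}).topologicalClosure = ⊤)
    {ι : Type*} {B : ι → Type*} {C : Type*} [∀ i, CStarAlgebra (B i)] [CStarAlgebra C]
    (f : ∀ i, A →⋆ₐ[ℂ] B i) (g : A →⋆ₐ[ℂ] C)
    (hfg : ∀ z ∈ powerAlgebra q U V, (∀ i, f i z = 0) → g z = 0) (a : A)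
    (ha : ∀ i, f i a = 0) : g a = 0 := by
  have h0 := hfg _ (average_mem hq h hα hgen (star a * a)) (fun i => by
    simp [average, map_sum, ha i])
  let _ := CStarAlgebra.spectralOrder C
  let _ := CStarAlgebra.spectralOrderedRing C
  let x : ℕ → ℕ → C := fun j k => g (a * star V ^ k * star U ^ j)
  have hsum : ∑ j ∈ Finset.range q, ∑ k ∈ Finset.range q, star (x j k) * x j k = 0 := by
    rw [← h0, average, map_sum]
    refine Finset.sum_congr rfl fun j _ => ?_
    rw [map_sum]
    refine Finset.sum_congr rfl fun k _ => ?_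
    simp only [x, ← map_star, ← map_mul]
    congr 1
    simp only [star_mul, star_pow, star_star]
    noncomm_ring
  have hpos : ∀ j ∈ Finset.range q, 0 ≤ ∑ k ∈ Finset.range q, star (x j k) * x j k :=
    fun j _ => Finset.sum_nonneg fun k _ => star_mul_self_nonneg _
  have h00 := (Finset.sum_eq_zero_iff_of_nonneg hpos).1 hsum 0 (Finset.mem_range.2 hq)
  have := (Finset.sum_eq_zero_iff_of_nonneg (fun k _ => star_mul_self_nonneg (x 0 k))).1 h00 0
    (Finset.mem_range.2 hq)
  rw [CStarRing.star_mul_self_eq_zero_iff] at this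
  simpa [x] using this

end RotationAlgebra

namespace Harper

/-! ### The Fourier matrix and the matrix frames -/

/-- `e(t) = exp (2 π i t)`. -/
noncomputable def e (t : ℝ) : ℂ := Complex.exp (2 * Real.pi * Complex.I * t)

theorem e_add (s t : ℝ) : e (s + t) = e s * e t := by
  rw [e, e, e, ← Complex.exp_add]
  congr 1
  push_cast
  ring

theorem e_int (n : ℤ) : e n = 1 := by
  rw [e, Complex.exp_eq_one_iff]
  exact ⟨n, by push_cast; ring⟩

theorem e_zero : e 0 = 1 := by simpa using e_int 0

theorem e_nat_mul (n : ℕ) (t : ℝ) : e t ^ n = e (n * t) := by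
  rw [e, e, ← Complex.exp_nat_mul]
  congr 1
  push_cast
  ring

theorem star_e (t : ℝ) : star (e t) = e (-t) := by
  change (starRingEnd ℂ) _ = _
  rw [e, e, ← Complex.exp_conj]
  simp [Complex.conj_ofNat]

theorem star_e_mul (t : ℝ) : star (e t) * e t = 1 := by
  rw [star_e, ← e_add, neg_add_cancel, e_zero]

theorem e_mul_star (t : ℝ) : e t * star (e t) = 1 := by
  rw [mul_comm, star_e_mul]

theorem e_add_star (t : ℝ) : e t + star (e t) = 2 * (Real.cos (2 * Real.pi * t) : ℂ) := by
  rw [star_e, e, e, Complex.ofReal_cos, Complex.two_cos]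
  push_cast
  ring_nf

theorem e_eq_one_iff (t : ℝ) : e t = 1 ↔ ∃ n : ℤ, t = n := by
  rw [e, Complex.exp_eq_one_iff]
  refine exists_congr fun n => ⟨fun h => ?_, fun h => by rw [h]; push_cast; ring⟩
  have : (t : ℂ) = (n : ℂ) := by
    have h2 : (2 * Real.pi * Complex.I : ℂ) ≠ 0 := Complex.two_pi_I_ne_zero
    refine mul_left_cancel₀ h2 ?_
    rw [h]; ring
  exact_mod_cast this

theorem exists_e_eq {z : ℂ} (hz : ‖z‖ = 1) : ∃ t : ℝ, e t = z := by
  refine ⟨Complex.arg z / (2 * Real.pi), ?_⟩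
  have h := Complex.norm_mul_exp_arg_mul_I z
  rw [hz, Complex.ofReal_one, one_mul] at h
  rw [e]
  conv_rhs => rw [← h]
  congr 1
  push_cast
  have : (Real.pi : ℂ) ≠ 0 := by exact_mod_cast Real.pi_ne_zero
  field_simp

variable {q : ℕ}

theorem q_ne_zero_real [NeZero q] : (q : ℝ) ≠ 0 := by exact_mod_cast NeZero.ne q

theorem dft_apply (j k : Fin q) : dft q j k = (Real.sqrt q : ℂ)⁻¹ * e (j.1 * k.1 / q) := by
  rw [dft, Matrix.of_apply, e, ← Complex.exp_nat_mul]
  congr 2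
  push_cast
  ring

theorem inv_sqrt_mul_inv_sqrt : (Real.sqrt q : ℂ)⁻¹ * (Real.sqrt q : ℂ)⁻¹ = (q : ℂ)⁻¹ := by
  rw [← mul_inv, ← Complex.ofReal_mul, Real.mul_self_sqrt (Nat.cast_nonneg q), Complex.ofReal_natCast]

/-- Orthogonality of the characters of `ℤ / q`. -/
theorem sum_e [NeZero q] (m : ℤ) :
    ∑ l : Fin q, e (m * l.1 / q) = if (q : ℤ) ∣ m then (q : ℂ) else 0 := by
  have hq := q_ne_zero_real (q := q)
  have hpow : ∀ l : ℕ, e (m * l / q) = e (m / q) ^ l := fun l => by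
    rw [e_nat_mul]; congr 1; ring
  rw [Fin.sum_univ_eq_sum_range (fun l => e (m * l / q)) q]
  simp only [hpow]
  split_ifs with h
  · obtain ⟨n, rfl⟩ := h
    have : e (((q : ℤ) * n : ℤ) / q) = 1 := by
      rw [← e_int n]; congr 1; push_cast; field_simp
    simp only [this]
    simp
  · have h1 : e (m / q) ≠ 1 := by
      rw [Ne, e_eq_one_iff]
      rintro ⟨n, hn⟩
      refine h ⟨n, ?_⟩
      rw [div_eq_iff hq] at hn
      have : m = n * q := by exact_mod_cast hn
      rw [this, mul_comm]
    have h2 : e (m / q) ^ q = 1 := by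
      rw [e_nat_mul, ← e_int m]; congr 1; field_simp
    have := geom_sum_mul (e (m / q)) q
    rw [h2, sub_self, mul_eq_zero] at this
    exact this.resolve_right (sub_ne_zero.2 h1)

theorem dvd_sub_iff (j k : Fin q) : (q : ℤ) ∣ (j.1 : ℤ) - k.1 ↔ j = k := by
  constructor
  · intro h
    have := Int.eq_zero_of_abs_lt_dvd h (by rw [abs_lt]; omega)
    exact Fin.ext (by omega)
  · rintro rfl; simp

theorem dft_mul_star [NeZero q] : dft q * star (dft q) = 1 := by
  ext j k
  have : ∀ l : Fin q, dft q j l * star (dft q) l k =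
      (q : ℂ)⁻¹ * e (((j.1 : ℤ) - k.1 : ℤ) * l.1 / q) := by
    intro l
    rw [Matrix.star_apply, dft_apply, dft_apply, star_mul', star_inv₀, star_e]
    have : star (Real.sqrt q : ℂ) = Real.sqrt q := Complex.conj_ofReal _
    rw [this, ← inv_sqrt_mul_inv_sqrt, mul_mul_mul_comm, ← e_add]
    congr 2
    push_cast
    ring
  rw [Matrix.mul_apply, Finset.sum_congr rfl fun l _ => this l, ← Finset.mul_sum, sum_e,
    Matrix.one_apply]
  simp only [dvd_sub_iff]
  split_ifs
  · exact inv_mul_cancel₀ (by exact_mod_cast NeZero.ne q)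
  · simp

theorem dft_mem_unitary [NeZero q] : dft q ∈ unitary (Matrix (Fin q) (Fin q) ℂ) :=
  Matrix.mem_unitaryGroup_iff.2 dft_mul_star

theorem star_mul_dft [NeZero q] : star (dft q) * dft q = 1 := (Unitary.mem_iff.1 dft_mem_unitary).1

theorem dft_inv [NeZero q] : (dft q)⁻¹ = star (dft q) := Matrix.inv_eq_right_inv dft_mul_star

theorem isUnit_dft [NeZero q] : IsUnit (dft q) := ⟨⟨_, _, dft_mul_star, star_mul_dft⟩, rfl⟩

theorem dft_inv_apply [NeZero q] (j k : Fin q) :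
    (dft q)⁻¹ j k = (Real.sqrt q : ℂ)⁻¹ * e (-(j.1 * k.1 / q)) := by
  rw [dft_inv, Matrix.star_apply, dft_apply, star_mul', star_inv₀, star_e]
  have : star (Real.sqrt q : ℂ) = Real.sqrt q := Complex.conj_ofReal _
  rw [this, mul_comm (k.1 : ℝ)]

/-- The diagonal unitary matrix with entries `e(y + k j / q)`, `0 ≤ j < q`. -/
noncomputable def phaseDiag (q : ℕ) (k : ℤ) (y : ℝ) : Matrix (Fin q) (Fin q) ℂ :=
  Matrix.diagonal fun j => e (y + k * j.1 / q)

theorem phaseDiag_mem_unitary (k : ℤ) (y : ℝ) :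
    phaseDiag q k y ∈ unitary (Matrix (Fin q) (Fin q) ℂ) := by
  refine Matrix.mem_unitaryGroup_iff.2 ?_
  rw [phaseDiag, Matrix.star_eq_conjTranspose, Matrix.diagonal_conjTranspose,
    Matrix.diagonal_mul_diagonal, ← Matrix.diagonal_one]
  congr 1
  funext j
  exact e_mul_star _

theorem phaseDiag_pow [NeZero q] (k : ℤ) (y : ℝ) : phaseDiag q k y ^ q = e (q * y) • 1 := by
  rw [phaseDiag, Matrix.diagonal_pow, ← Matrix.diagonal_one, ← Matrix.diagonal_smul]
  congr 1
  funext j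
  have hq := q_ne_zero_real (q := q)
  rw [Pi.pow_apply, e_nat_mul, Pi.smul_apply, smul_eq_mul, mul_one, mul_add, e_add]
  have : e (q * (k * j.1 / q)) = 1 := by
    rw [← e_int (k * j.1)]; congr 1; push_cast; field_simp
  rw [this, mul_one]

theorem realPart_eq_smul {A : Type*} [CStarAlgebra A] (a : A) :
    (realPart a : A) = (2⁻¹ : ℂ) • (a + star a) := by
  rw [realPart_apply_coe, ← Complex.coe_smul]
  push_cast
  rfl

theorem realPart_phaseDiag (k : ℤ) (y : ℝ) :
    (2⁻¹ : ℂ) • (phaseDiag q k y + star (phaseDiag q k y)) = cosDiag q k y := by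
  rw [phaseDiag, Matrix.star_eq_conjTranspose, Matrix.diagonal_conjTranspose,
    Matrix.diagonal_add, ← Matrix.diagonal_smul, cosDiag]
  congr 1
  funext j
  change (2⁻¹ : ℂ) * (e _ + star (e _)) = _
  rw [e_add_star]
  ring

/-- The matrix `F diag(e(θ + p l / q)) F⁻¹`, that is `e(θ)` times the `p`-th power of the cyclic
shift. -/
noncomputable def shiftMatrix (p : ℤ) (q : ℕ) (θ : ℝ) : Matrix (Fin q) (Fin q) ℂ :=
  dft q * phaseDiag q p θ * star (dft q)

theorem shiftMatrix_mem_unitary [NeZero q] (p : ℤ) (θ : ℝ) :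
    shiftMatrix p q θ ∈ unitary (Matrix (Fin q) (Fin q) ℂ) :=
  mul_mem (mul_mem dft_mem_unitary (phaseDiag_mem_unitary p θ)) (Unitary.star_mem dft_mem_unitary)

theorem shiftMatrix_pow [NeZero q] (p : ℤ) (θ : ℝ) : shiftMatrix p q θ ^ q = e (q * θ) • 1 := by
  have key : ∀ n : ℕ, shiftMatrix p q θ ^ n = dft q * phaseDiag q p θ ^ n * star (dft q) := by
    intro n
    induction n with
    | zero => rw [pow_zero, pow_zero, mul_one, dft_mul_star]
    | succ n ih =>
      rw [pow_succ, ih, pow_succ, shiftMatrix]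
      calc _ = dft q * phaseDiag q p θ ^ n * (star (dft q) * dft q) * phaseDiag q p θ *
            star (dft q) := by noncomm_ring
        _ = _ := by rw [star_mul_dft]; noncomm_ring
  rw [key, phaseDiag_pow, mul_smul_comm, mul_one, smul_mul_assoc, dft_mul_star]

theorem realPart_shiftMatrix [NeZero q] (p : ℤ) (θ : ℝ) :
    (2⁻¹ : ℂ) • (shiftMatrix p q θ + star (shiftMatrix p q θ)) =
      dft q * cosDiag q p θ * (dft q)⁻¹ := by
  rw [← realPart_phaseDiag, dft_inv, shiftMatrix, star_mul, star_mul, star_star, mul_smul_comm,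
    smul_mul_assoc, mul_add, add_mul, mul_assoc (dft q) (star (phaseDiag q p θ))]

theorem shiftMatrix_apply [NeZero q] (p : ℤ) (θ : ℝ) (j k : Fin q) :
    shiftMatrix p q θ j k =
      if (q : ℤ) ∣ (j.1 : ℤ) + p - k.1 then e θ else 0 := by
  have hterm : ∀ l : Fin q, (dft q * phaseDiag q p θ) j l * star (dft q) l k =
      (q : ℂ)⁻¹ * e θ * e (((j.1 : ℤ) + p - k.1 : ℤ) * l.1 / q) := by
    intro l
    rw [phaseDiag, Matrix.mul_diagonal, ← dft_inv, dft_inv_apply, dft_apply,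
      ← inv_sqrt_mul_inv_sqrt, e_add]
    have : e (((j.1 : ℤ) + p - k.1 : ℤ) * l.1 / q) =
        e (j.1 * l.1 / q) * e (p * l.1 / q) * e (-(l.1 * k.1 / q)) := by
      rw [← e_add, ← e_add]
      congr 1
      push_cast
      ring
    rw [this]
    ring
  rw [shiftMatrix, Matrix.mul_apply, Finset.sum_congr rfl fun l _ => hterm l, ← Finset.mul_sum,
    sum_e]
  have : (q : ℂ) ≠ 0 := by exact_mod_cast NeZero.ne q
  split_ifs
  · field_simp
  · simp

theorem isFrame_matrix [NeZero q] (p : ℤ) (x θ : ℝ) :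
    IsFrame ((p : ℝ) / q) (shiftMatrix p q θ) (phaseDiag q 1 x) where
  unitary_left := shiftMatrix_mem_unitary p θ
  unitary_right := phaseDiag_mem_unitary 1 x
  comm := by
    have hq := q_ne_zero_real (q := q)
    change _ = e ((p : ℝ) / q) • _
    ext j k
    rw [Matrix.smul_apply, phaseDiag, Matrix.mul_diagonal, Matrix.diagonal_mul, shiftMatrix_apply]
    split_ifs with h
    · obtain ⟨m, hm⟩ := h
      have hm' : (k.1 : ℝ) = j.1 + p - q * m := by
        have : (k.1 : ℤ) = j.1 + p - q * m := by rw [← hm]; ring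
        exact_mod_cast congrArg (Int.cast : ℤ → ℝ) this
      have hk : e (x + (1 : ℤ) * k.1 / q) = e (p / q) * e (x + (1 : ℤ) * j.1 / q) := by
        rw [hm', ← e_add, ← mul_one (e (p / q + _)), ← e_int (-m), ← e_add]
        congr 1
        push_cast
        field_simp
        ring
      rw [hk, smul_eq_mul]
      ring
    · simp

/-! ### The circulant form of the kicked matrix -/

theorem exp_smul_cosDiag (s : ℝ) (k : ℤ) (y : ℝ) {c : ℂ} (hc : c = -2 * Complex.I * s) :
    NormedSpace.exp (c • cosDiag q k y) = Matrix.diagonal (kickPhase q s k y) := by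
  rw [cosDiag, ← Matrix.diagonal_smul, Matrix.exp_diagonal]
  congr 1
  funext j
  rw [Pi.coe_exp, ← Complex.exp_eq_exp_ℂ, kickPhase, hc]
  rfl

theorem kickedMatrix_eq (κ : ℝ) (p : ℤ) (lam x θ : ℝ) :
    kickedMatrix κ p q lam x θ = Matrix.diagonal (kickPhase q κ 1 x) * dft q *
      Matrix.diagonal (kickPhase q (κ * lam) p θ) * (dft q)⁻¹ := by
  rw [kickedMatrix, exp_smul_cosDiag κ 1 x rfl,
    exp_smul_cosDiag (κ * lam) p θ (by push_cast; ring)]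

theorem dft_mul_inv [NeZero q] : dft q * (dft q)⁻¹ = 1 := by rw [dft_inv, dft_mul_star]

theorem unitarilyEquivalent_kickedMatrix [NeZero q] (κ : ℝ) (p : ℤ) (lam x θ : ℝ) :
    UnitarilyEquivalent (kickedMatrix κ p q lam x θ)
      ((dft q)⁻¹ * Matrix.diagonal (kickPhase q κ 1 x) * dft q *
        Matrix.diagonal (kickPhase q (κ * lam) p θ)) := by
  refine ⟨dft q, dft_mem_unitary, ?_⟩
  simp only [kickedMatrix_eq, ← mul_assoc, dft_mul_inv, one_mul]

theorem e_val_sub_mul [NeZero q] (j k l : Fin q) :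
    e ((k - j).1 * l.1 / q) = e (-(j.1 * l.1 / q)) * e (l.1 * k.1 / q) := by
  have hq := q_ne_zero_real (q := q)
  obtain ⟨m, hm⟩ : ∃ m : ℤ, ((k - j).1 : ℤ) = k.1 - j.1 + q * m := by
    have h1 := Nat.div_add_mod (q - j.1 + k.1) q
    rw [Fin.val_sub]
    refine ⟨1 - ((q - j.1 + k.1) / q : ℕ), ?_⟩
    have h2 : ((q - j.1 : ℕ) : ℤ) = q - j.1 := by have := j.2; omega
    have h3 := congrArg (Nat.cast : ℕ → ℤ) h1
    rw [Nat.cast_add, Nat.cast_mul, Nat.cast_add, h2] at h3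
    linarith
  have hm' : ((k - j).1 : ℝ) = k.1 - j.1 + q * m := by exact_mod_cast congrArg (Int.cast : ℤ → ℝ) hm
  rw [hm', ← e_add, ← mul_one (e (_ + _)), ← e_int (m * l.1), ← e_add]
  congr 1
  push_cast
  field_simp
  ring

/-- Conjugating a diagonal matrix by the Fourier matrix gives a circulant. -/
theorem dft_conj_eq_rowCirculant [NeZero q] (κ x : ℝ) :
    (dft q)⁻¹ * Matrix.diagonal (kickPhase q κ 1 x) * dft q = rowCirculant (firstRow q κ x) := by
  ext j k
  rw [Matrix.mul_apply, rowCirculant, Matrix.of_apply, firstRow, Pi.smul_apply, Matrix.mulVec,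
    dotProduct, smul_eq_mul, Finset.mul_sum]
  refine Finset.sum_congr rfl fun l _ => ?_
  rw [Matrix.mul_diagonal, dft_inv_apply, dft_apply, dft_apply, e_val_sub_mul]
  ring

theorem kickedMatrix_eq_exp_mul_exp [NeZero q] (κ : ℝ) (p : ℤ) (lam x θ : ℝ) :
    kickedMatrix κ p q lam x θ = NormedSpace.exp ((-2 * Complex.I * κ) • cosDiag q 1 x) *
      NormedSpace.exp ((-2 * Complex.I * κ * lam) • (dft q * cosDiag q p θ * (dft q)⁻¹)) := by
  rw [kickedMatrix, ← smul_mul_assoc, ← mul_smul_comm, Matrix.exp_conj _ _ isUnit_dft]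
  simp only [mul_assoc]

/-! ### The finite-dimensional representations of the rational rotation algebra -/

section Rep

variable [NeZero q] (p : ℤ) (x θ : ℝ)

theorem exists_matrixRep (p : ℤ) (q : ℕ) [NeZero q] (x θ : ℝ) :
    ∃ π : UniversalAlgebra ((p : ℝ) / q) →⋆ₐ[ℂ] Matrix (Fin q) (Fin q) ℂ,
      π (univU _) = shiftMatrix p q θ ∧ π (univV _) = phaseDiag q 1 x :=
  (existsUnique_hom _ (isFrame_matrix p x θ)).exists

/-- The representation of `A_{p/q}` on `ℂ^q` with parameters `x` and `θ`. -/
noncomputable def matrixRep (p : ℤ) (q : ℕ) [NeZero q] (x θ : ℝ) :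
    UniversalAlgebra ((p : ℝ) / q) →⋆ₐ[ℂ] Matrix (Fin q) (Fin q) ℂ :=
  (exists_matrixRep p q x θ).choose

theorem matrixRep_univU : matrixRep p q x θ (univU _) = shiftMatrix p q θ :=
  (exists_matrixRep p q x θ).choose_spec.1

theorem matrixRep_univV : matrixRep p q x θ (univV _) = phaseDiag q 1 x :=
  (exists_matrixRep p q x θ).choose_spec.2

theorem matrixRep_realPart_univU : matrixRep p q x θ (realPart (univU ((p : ℝ) / q))) =
    dft q * cosDiag q p θ * (dft q)⁻¹ := by
  rw [realPart_eq_smul, map_smul, map_add, map_star, matrixRep_univU, realPart_shiftMatrix]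

theorem matrixRep_realPart_univV : matrixRep p q x θ (realPart (univV ((p : ℝ) / q))) =
    cosDiag q 1 x := by
  rw [realPart_eq_smul, map_smul, map_add, map_star, matrixRep_univV, realPart_phaseDiag]

theorem matrixRep_motherUnitaryHarper (κ lam : ℝ) :
    matrixRep p q x θ (motherUnitaryHarper κ ((p : ℝ) / q) lam) = harperMatrix κ p q lam x θ := by
  rw [motherUnitaryHarper, StarAlgHom.map_normedSpace_exp, map_add, map_smul, map_smul,
    matrixRep_realPart_univU, matrixRep_realPart_univV, harperMatrix, smul_add, smul_smul]

theorem matrixRep_motherKickedHarper (κ lam : ℝ) :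
    matrixRep p q x θ (motherKickedHarper κ ((p : ℝ) / q) lam) = kickedMatrix κ p q lam x θ := by
  rw [motherKickedHarper, map_mul, StarAlgHom.map_normedSpace_exp, StarAlgHom.map_normedSpace_exp,
    map_smul, map_smul, matrixRep_realPart_univU, matrixRep_realPart_univV,
    kickedMatrix_eq_exp_mul_exp]

end Rep

end Harper

/-! ### The representation on `L²(𝕋)` -/

namespace Harper

theorem clm_ext_fourierLp {S T : L2T →L[ℂ] L2T}
    (h : ∀ n : ℤ, S (fourierLp 2 n) = T (fourierLp 2 n)) : S = T := by
  refine ContinuousLinearMap.ext_on (s := Set.range (fourierLp (T := (1 : ℝ)) 2)) ?_ ?_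
  · exact Submodule.dense_iff_topologicalClosure_eq_top.2 (span_fourierLp_closure_eq_top (by simp))
  · rintro _ ⟨n, rfl⟩
    exact h n

/-- Multiplication by `ξ₁`. -/
noncomputable abbrev posOp : L2T →L[ℂ] L2T := mulOp (fourierLp ∞ 1)

theorem posOp_mem_unitary : posOp ∈ unitary (L2T →L[ℂ] L2T) := by
  rw [Unitary.mem_iff, posOp, star_mulOp]
  constructor <;> refine clm_ext_fourierLp fun n => ?_
  · change mulOp (fourierLp ∞ (-1)) (mulOp (fourierLp ∞ 1) _) = _
    rw [mulOp_apply, mulOp_apply, add_neg_cancel_right]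
    rfl
  · change mulOp (fourierLp ∞ 1) (mulOp (fourierLp ∞ (-1)) _) = _
    rw [mulOp_apply, mulOp_apply, neg_add_cancel_right]
    rfl

theorem rotOp_fourierLp (α : ℝ) (n : ℤ) :
    rotOp α (fourierLp 2 n) = e (n * α) • (fourierLp 2 n : L2T) := by
  rw [rotOp_apply, e]
  congr 2
  push_cast
  ring

theorem star_rotOp_fourierLp (α : ℝ) (n : ℤ) :
    star (rotOp α) (fourierLp 2 n) = e (-(n * α)) • (fourierLp 2 n : L2T) := by
  rw [star_rotOp_apply, e]
  congr 2
  push_cast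
  ring

/-- The unitary operator `ξ₁(θ) R(α)`. -/
noncomputable abbrev momOp (α θ : ℝ) : L2T →L[ℂ] L2T := e θ • rotOp α

theorem momOp_fourierLp (α θ : ℝ) (n : ℤ) :
    momOp α θ (fourierLp 2 n) = e (θ + n * α) • (fourierLp 2 n : L2T) := by
  change e θ • rotOp α _ = _
  rw [rotOp_fourierLp, smul_smul, e_add]

theorem momOp_mem_unitary (α θ : ℝ) : momOp α θ ∈ unitary (L2T →L[ℂ] L2T) := by
  have hstar : ∀ n : ℤ, star (momOp α θ) (fourierLp 2 n) =
      e (-(θ + n * α)) • (fourierLp 2 n : L2T) := by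
    intro n
    rw [momOp, star_smul, star_e]
    change e (-θ) • star (rotOp α) _ = _
    rw [star_rotOp_fourierLp, smul_smul, ← e_add, neg_add]
  rw [Unitary.mem_iff]
  constructor <;> refine clm_ext_fourierLp fun n => ?_
  · change star (momOp α θ) (momOp α θ _) = _
    rw [momOp_fourierLp, map_smul, hstar, smul_smul, ← e_add, add_neg_cancel, e_zero, one_smul]
    rfl
  · change momOp α θ (star (momOp α θ) _) = _
    rw [hstar, map_smul, momOp_fourierLp, smul_smul, ← e_add, neg_add_cancel, e_zero, one_smul]
    rfl

theorem isFrame_l2 (α θ : ℝ) : IsFrame α (momOp α θ) posOp where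
  unitary_left := momOp_mem_unitary α θ
  unitary_right := posOp_mem_unitary
  comm := by
    change _ = e α • _
    refine clm_ext_fourierLp fun n => ?_
    change momOp α θ (mulOp (fourierLp ∞ 1) _) = e α • mulOp (fourierLp ∞ 1) (momOp α θ _)
    rw [momOp_fourierLp, map_smul, mulOp_apply, momOp_fourierLp, smul_smul, ← e_add]
    congr 2
    push_cast
    ring

theorem momOp_pow (p : ℤ) (q : ℕ) [NeZero q] (θ : ℝ) :
    momOp ((p : ℝ) / q) θ ^ q = e (q * θ) • 1 := by
  have hq := q_ne_zero_real (q := q)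
  have key : ∀ (m : ℕ) (n : ℤ), (momOp ((p : ℝ) / q) θ ^ m) (fourierLp 2 n) =
      e (θ + n * ((p : ℝ) / q)) ^ m • (fourierLp 2 n : L2T) := by
    intro m n
    induction m with
    | zero => simp
    | succ m ih =>
      rw [pow_succ']
      change momOp _ θ ((momOp _ θ ^ m) _) = _
      rw [ih, map_smul, momOp_fourierLp, smul_smul, pow_succ]
  refine clm_ext_fourierLp fun n => ?_
  change _ = e (q * θ) • (fourierLp 2 n : L2T)
  rw [key, e_nat_mul, mul_add, e_add]
  have : e (q * (n * ((p : ℝ) / q))) = 1 := by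
    rw [← e_int (n * p)]; congr 1; push_cast; field_simp
  rw [this, mul_one]

instance : Nontrivial L2T := by
  refine ⟨⟨fourierLp 2 0, 0, fun h => ?_⟩⟩
  have := (orthonormal_fourier (T := (1 : ℝ))).1 0
  rw [h, norm_zero] at this
  exact zero_ne_one this

/-- Every power of multiplication by `ξ₁` has the full unit circle as spectrum, because conjugation
by rotations rotates the spectrum. -/
theorem mem_spectrum_posOp_pow {q : ℕ} (hq : q ≠ 0) {z : ℂ} (hz : ‖z‖ = 1) :
    z ∈ spectrum ℂ (posOp ^ q) := by
  obtain ⟨w, hw⟩ := spectrum.nonempty (posOp ^ q)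
  have hw1 : ‖w‖ = 1 := by
    have := Unitary.spectrum_subset_circle (𝕜 := ℂ) ⟨posOp ^ q, pow_mem posOp_mem_unitary q⟩ hw
    simpa using this
  have hw0 : w ≠ 0 := fun h => by rw [h, norm_zero] at hw1; exact zero_ne_one hw1
  obtain ⟨t, ht⟩ := exists_e_eq (z := z / w) (by rw [norm_div, hz, hw1, div_one])
  have hq' : (q : ℝ) ≠ 0 := by exact_mod_cast hq
  have hf := isFrame_l2 (t / q) 0
  have hcomm := hf.left_mul_pow q
  have hphase : IsFrame.phase (t / q) ^ q = z / w := by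
    change e (t / q) ^ q = _
    rw [e_nat_mul, ← ht]
    congr 1
    field_simp
  rw [hphase] at hcomm
  set U := momOp (t / q) 0
  have hconj : U * posOp ^ q * star U = (z / w) • posOp ^ q := by
    rw [hcomm, smul_mul_assoc, mul_assoc, hf.left_mul_star, mul_one]
  have hspec : spectrum ℂ (U * posOp ^ q * star U) = spectrum ℂ (posOp ^ q) :=
    spectrum.units_conjugate (u := ⟨U, star U, hf.left_mul_star, hf.star_mul_left⟩)
  rw [← hspec, hconj]
  have hz0 : z / w ≠ 0 := div_ne_zero (fun h => by rw [h, norm_zero] at hz; exact zero_ne_one hz) hw0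
  have := spectrum.unit_smul_eq_smul (posOp ^ q) (Units.mk0 _ hz0)
  rw [Units.smul_mk0, Units.smul_mk0] at this
  rw [this]
  exact ⟨w, hw, div_mul_cancel₀ z hw0⟩

section Rep

variable (α θ : ℝ)

theorem exists_l2Rep : ∃ π : UniversalAlgebra α →⋆ₐ[ℂ] (L2T →L[ℂ] L2T),
    π (univU _) = momOp α θ ∧ π (univV _) = posOp :=
  (existsUnique_hom _ (isFrame_l2 α θ)).exists

/-- The representation of `A_α` on `L²(𝕋)` that maps the generators to `ξ₁(θ) R(α)` and
multiplication by `ξ₁`. -/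
noncomputable def l2Rep : UniversalAlgebra α →⋆ₐ[ℂ] (L2T →L[ℂ] L2T) := (exists_l2Rep α θ).choose

theorem l2Rep_univU : l2Rep α θ (univU _) = momOp α θ := (exists_l2Rep α θ).choose_spec.1

theorem l2Rep_univV : l2Rep α θ (univV _) = posOp := (exists_l2Rep α θ).choose_spec.2

theorem l2Rep_realPart_univU : l2Rep α θ (realPart (univU α)) = cosMom α θ := by
  rw [realPart_eq_smul, map_smul, map_add, map_star, l2Rep_univU, cosMom]
  exact (realPart_eq_smul _).symm

theorem l2Rep_realPart_univV : l2Rep α θ (realPart (univV α)) = cosPos := by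
  rw [realPart_eq_smul, map_smul, map_add, map_star, l2Rep_univV, cosPos]
  exact (realPart_eq_smul _).symm

theorem l2Rep_motherUnitaryHarper (κ lam : ℝ) :
    l2Rep α θ (motherUnitaryHarper κ α lam) = unitaryHarper κ α lam θ := by
  rw [motherUnitaryHarper, StarAlgHom.map_normedSpace_exp, map_add, map_smul, map_smul,
    l2Rep_realPart_univU, l2Rep_realPart_univV, unitaryHarper, harperH, smul_add, smul_smul,
    smul_smul]
  congr 3 <;> ring

theorem l2Rep_motherKickedHarper (κ lam : ℝ) :
    l2Rep α θ (motherKickedHarper κ α lam) = kickedHarper κ α lam θ := by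
  rw [motherKickedHarper, map_mul, StarAlgHom.map_normedSpace_exp, StarAlgHom.map_normedSpace_exp,
    map_smul, map_smul, l2Rep_realPart_univU, l2Rep_realPart_univV, kickedHarper]

end Rep

end Harper

/-! ### Kernels and spectra of the representations -/

namespace RotationAlgebra

section PowerAlgebra

variable {A C : Type*} [CStarAlgebra A] [CStarAlgebra C] {q : ℕ} {U V : A}

theorem powerAlgebra_hom_ext {f g : powerAlgebra q U V →⋆ₐ[ℂ] C}
    (hU : f ⟨U ^ q, left_pow_mem q U V⟩ = g ⟨U ^ q, left_pow_mem q U V⟩)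
    (hV : f ⟨V ^ q, right_pow_mem q U V⟩ = g ⟨V ^ q, right_pow_mem q U V⟩) : f = g := by
  have : IsClosed (powerAlgebra q U V : Set A) := isClosed_powerAlgebra q U V
  refine StarAlgHom.ext_topologicalClosure (map_continuous f) (map_continuous g) ?_
  refine StarAlgHom.ext_adjoin ?_
  rintro ⟨x, hx⟩ (rfl | rfl)
  exacts [hU, hV]

theorem map_mem_powerAlgebra (π : A →⋆ₐ[ℂ] C) {z : A} (hz : z ∈ powerAlgebra q U V) :
    π z ∈ powerAlgebra q (π U) (π V) := by
  have h : powerAlgebra q U V ≤ (powerAlgebra q (π U) (π V)).comap π := by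
    refine powerAlgebra_le ?_ ?_ ?_
    · exact (isClosed_powerAlgebra q (π U) (π V)).preimage (map_continuous π)
    · rw [StarSubalgebra.mem_comap, map_pow]
      exact left_pow_mem q _ _
    · rw [StarSubalgebra.mem_comap, map_pow]
      exact right_pow_mem q _ _
  exact h hz

/-- The restriction of a star homomorphism to `powerAlgebra`. -/
noncomputable def powerAlgebraMap (π : A →⋆ₐ[ℂ] C) :
    powerAlgebra q U V →⋆ₐ[ℂ] powerAlgebra q (π U) (π V) where
  toFun z := ⟨π z, map_mem_powerAlgebra π z.2⟩
  map_one' := Subtype.ext (map_one π)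
  map_mul' _ _ := Subtype.ext (map_mul π _ _)
  map_zero' := Subtype.ext (map_zero π)
  map_add' _ _ := Subtype.ext (map_add π _ _)
  commutes' r := Subtype.ext (AlgHomClass.commutes π r)
  map_star' _ := Subtype.ext (map_star π _)

theorem IsFrame.map {α : ℝ} (h : IsFrame α U V) (π : A →⋆ₐ[ℂ] C) : IsFrame α (π U) (π V) where
  unitary_left := Unitary.map_mem π h.unitary_left
  unitary_right := Unitary.map_mem π h.unitary_right
  comm := by rw [← map_mul, h.comm, map_smul, map_mul]

theorem norm_character_eq_one {S : StarSubalgebra ℂ A} (χ : S →⋆ₐ[ℂ] ℂ) {u : A} (hu : u ∈ unitary A)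
    (huS : u ∈ S) : ‖χ ⟨u, huS⟩‖ = 1 := by
  have h : (⟨u, huS⟩ : S) ∈ unitary S := Unitary.mem_iff.2
    ⟨Subtype.ext (Unitary.mem_iff.1 hu).1, Subtype.ext (Unitary.mem_iff.1 hu).2⟩
  exact CStarRing.norm_of_mem_unitary (Unitary.map_mem χ h)

end PowerAlgebra

end RotationAlgebra

namespace Harper

theorem isPrimitiveRoot_phase {p : ℤ} {q : ℕ} [NeZero q] (hpq : IsCoprime p (q : ℤ)) :
    IsPrimitiveRoot (IsFrame.phase ((p : ℝ) / q)) q := by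
  have hq := q_ne_zero_real (q := q)
  constructor
  · change e _ ^ q = 1
    rw [e_nat_mul, ← e_int p]
    congr 1
    field_simp
  · intro l hl
    change e _ ^ l = 1 at hl
    rw [e_nat_mul, e_eq_one_iff] at hl
    obtain ⟨n, hn⟩ := hl
    have h : (l : ℝ) * p = n * q := by field_simp at hn; linarith
    have h' : (l : ℤ) * p = n * q := by exact_mod_cast h
    have hd : (q : ℤ) ∣ l := hpq.symm.dvd_of_dvd_mul_right ⟨n, by rw [h', mul_comm]⟩
    exact_mod_cast hd

section Kernels

variable {p : ℤ} {q : ℕ} [NeZero q] {C : Type*} [CStarAlgebra C]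

/-- On `powerAlgebra` the representation `matrixRep p q x θ` is scalar: it is the character with
values `e(q θ)` at `U ^ q` and `e(q x)` at `V ^ q`. -/
theorem matrixRep_eq_character (π : UniversalAlgebra ((p : ℝ) / q) →⋆ₐ[ℂ] C)
    (χ : powerAlgebra q (π (univU _)) (π (univV _)) →⋆ₐ[ℂ] ℂ) {x θ : ℝ}
    (hU : χ ⟨π (univU _) ^ q, left_pow_mem q _ _⟩ = e (q * θ))
    (hV : χ ⟨π (univV _) ^ q, right_pow_mem q _ _⟩ = e (q * x))
    (z : powerAlgebra q (univU ((p : ℝ) / q)) (univV ((p : ℝ) / q))) :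
    matrixRep p q x θ z = algebraMap ℂ _ (χ (powerAlgebraMap π z)) := by
  have key : (matrixRep p q x θ).comp (StarSubalgebra.subtype _) =
      (StarAlgHom.ofId ℂ (Matrix (Fin q) (Fin q) ℂ)).comp (χ.comp (powerAlgebraMap π)) := by
    refine powerAlgebra_hom_ext ?_ ?_
    · change matrixRep p q x θ (univU _ ^ q) = algebraMap ℂ _ (χ ⟨π (univU _ ^ q), _⟩)
      simp only [map_pow π]
      rw [hU, map_pow, matrixRep_univU, shiftMatrix_pow, Algebra.algebraMap_eq_smul_one]
    · change matrixRep p q x θ (univV _ ^ q) = algebraMap ℂ _ (χ ⟨π (univV _ ^ q), _⟩)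
      simp only [map_pow π]
      rw [hV, map_pow, matrixRep_univV, phaseDiag_pow, Algebra.algebraMap_eq_smul_one]
  exact DFunLike.congr_fun key z

/-- If the set `X` of parameters accounts for all characters of the image of `powerAlgebra` under `π`,
then an element killed by the matrix representations with parameters in `X` is killed by `π`. -/
theorem apply_eq_zero_of_matrixRep (hpq : IsCoprime p (q : ℤ))
    (π : UniversalAlgebra ((p : ℝ) / q) →⋆ₐ[ℂ] C) (X : Set (ℝ × ℝ))
    (hX : ∀ χ : powerAlgebra q (π (univU _)) (π (univV _)) →⋆ₐ[ℂ] ℂ, ∃ y ∈ X,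
      χ ⟨π (univU _) ^ q, left_pow_mem q _ _⟩ = e (q * y.2) ∧
        χ ⟨π (univV _) ^ q, right_pow_mem q _ _⟩ = e (q * y.1))
    (a : UniversalAlgebra ((p : ℝ) / q)) (ha : ∀ y : X, matrixRep p q y.1.1 y.1.2 a = 0) :
    π a = 0 := by
  have hα := isPrimitiveRoot_phase hpq
  refine forall_apply_eq_zero_of_powerAlgebra (NeZero.pos q) (univ_isFrame _) hα (univ_generates _)
    (fun y : X => matrixRep p q y.1.1 y.1.2) π (fun z hz h0 => ?_) a ha
  have hf := (univ_isFrame ((p : ℝ) / q)).map π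
  have := eq_zero_of_forall_character (isClosed_powerAlgebra q _ _)
    (powerAlgebra_comm hf hα.pow_eq_one) (powerAlgebraMap π ⟨z, hz⟩) (fun χ => ?_)
  · exact congrArg Subtype.val this
  · obtain ⟨y, hy, hU, hV⟩ := hX χ
    have h1 := matrixRep_eq_character π χ hU hV ⟨z, hz⟩
    rw [h0 ⟨y, hy⟩] at h1
    exact (map_eq_zero_iff _ (algebraMap ℂ (Matrix (Fin q) (Fin q) ℂ)).injective).1 h1.symm

/-- The matrix representation with parameters `x` and `θ` annihilates the kernel of `π` as soon as
its character factors through the image of `powerAlgebra` under `π`. -/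
theorem matrixRep_eq_zero_of_character (hpq : IsCoprime p (q : ℤ))
    (π : UniversalAlgebra ((p : ℝ) / q) →⋆ₐ[ℂ] C) {x θ : ℝ}
    (χ : powerAlgebra q (π (univU _)) (π (univV _)) →⋆ₐ[ℂ] ℂ)
    (hU : χ ⟨π (univU _) ^ q, left_pow_mem q _ _⟩ = e (q * θ))
    (hV : χ ⟨π (univV _) ^ q, right_pow_mem q _ _⟩ = e (q * x))
    (a : UniversalAlgebra ((p : ℝ) / q)) (ha : π a = 0) : matrixRep p q x θ a = 0 := by
  refine forall_apply_eq_zero_of_powerAlgebra (NeZero.pos q) (univ_isFrame _)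
    (isPrimitiveRoot_phase hpq) (univ_generates _) (fun _ : Unit => π) (matrixRep p q x θ)
    (fun z hz h0 => ?_) a (fun _ => ha)
  have h1 := matrixRep_eq_character π χ hU hV ⟨z, hz⟩
  have h2 : powerAlgebraMap π ⟨z, hz⟩ = 0 := Subtype.ext (h0 ())
  rw [h1, h2, map_zero, map_zero]

theorem matrixRep_eq_zero_of_e_eq (hpq : IsCoprime p (q : ℤ)) {x x' θ θ' : ℝ}
    (hx : e (q * x) = e (q * x')) (hθ : e (q * θ) = e (q * θ'))
    (a : UniversalAlgebra ((p : ℝ) / q)) (ha : matrixRep p q x θ a = 0) :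
    matrixRep p q x' θ' a = 0 := by
  refine forall_apply_eq_zero_of_powerAlgebra (NeZero.pos q) (univ_isFrame _)
    (isPrimitiveRoot_phase hpq) (univ_generates _) (fun _ : Unit => matrixRep p q x θ)
    (matrixRep p q x' θ') (fun z hz h0 => ?_) a (fun _ => ha)
  have key : (matrixRep p q x θ).comp (powerAlgebra q (univU _) (univV _)).subtype =
      (matrixRep p q x' θ').comp (powerAlgebra q (univU _) (univV _)).subtype := by
    refine powerAlgebra_hom_ext ?_ ?_
    · change matrixRep p q x θ (univU _ ^ q) = matrixRep p q x' θ' (univU _ ^ q)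
      rw [map_pow, map_pow, matrixRep_univU, matrixRep_univU, shiftMatrix_pow, shiftMatrix_pow, hθ]
    · change matrixRep p q x θ (univV _ ^ q) = matrixRep p q x' θ' (univV _ ^ q)
      rw [map_pow, map_pow, matrixRep_univV, matrixRep_univV, phaseDiag_pow, phaseDiag_pow, hx]
  exact (DFunLike.congr_fun key ⟨z, hz⟩).symm.trans (h0 ())

/-- The spectra of the matrices are periodic with period `1 / q` in both parameters. -/
theorem spectrum_matrixRep_eq (hpq : IsCoprime p (q : ℤ)) {x x' θ θ' : ℝ}
    (hx : e (q * x) = e (q * x')) (hθ : e (q * θ) = e (q * θ'))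
    {a : UniversalAlgebra ((p : ℝ) / q)} (ha : IsStarNormal a) :
    spectrum ℂ (matrixRep p q x θ a) = spectrum ℂ (matrixRep p q x' θ' a) := by
  have sub : ∀ {x x' θ θ' : ℝ}, e (q * x) = e (q * x') → e (q * θ) = e (q * θ') →
      spectrum ℂ (matrixRep p q x' θ' a) ⊆ spectrum ℂ (matrixRep p q x θ a) :=
    fun hx hθ => spectrum_subset_of_ker _ _ (matrixRep_eq_zero_of_e_eq hpq hx hθ) ha
  exact (sub hx.symm hθ.symm).antisymm (sub hx hθ)

theorem exists_e_mul_eq {z : ℂ} (hz : ‖z‖ = 1) : ∃ t : ℝ, z = e (q * t) := by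
  obtain ⟨t, rfl⟩ := exists_e_eq hz
  refine ⟨t / q, ?_⟩
  rw [mul_div_cancel₀ _ (q_ne_zero_real (q := q))]

/-- A character of `powerAlgebra` takes values of modulus `1` at `U ^ q` and `V ^ q`, so it belongs to
some pair of parameters. -/
theorem spectrum_subset_closure_matrixRep (hpq : IsCoprime p (q : ℤ))
    {a : UniversalAlgebra ((p : ℝ) / q)} (ha : IsStarNormal a) :
    spectrum ℂ a ⊆ closure (⋃ y : ℝ × ℝ, spectrum ℂ (matrixRep p q y.1 y.2 a)) := by
  refine spectrum_subset_closure_iUnion (fun y : ℝ × ℝ => matrixRep p q y.1 y.2)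
    (StarAlgHom.id ℂ _) (fun b hb => ?_) a ha
  refine apply_eq_zero_of_matrixRep hpq (StarAlgHom.id ℂ _) Set.univ (fun χ => ?_) b
    (fun y => hb y.1)
  have hf := univ_isFrame ((p : ℝ) / q)
  obtain ⟨θ, hθ⟩ := exists_e_mul_eq (q := q) (norm_character_eq_one χ
    (pow_mem hf.unitary_left q) (left_pow_mem q _ _))
  obtain ⟨x, hx⟩ := exists_e_mul_eq (q := q) (norm_character_eq_one χ
    (pow_mem hf.unitary_right q) (right_pow_mem q _ _))
  exact ⟨(x, θ), trivial, hθ, hx⟩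

theorem character_left_pow_l2Rep (θ : ℝ) (χ : powerAlgebra q (l2Rep ((p : ℝ) / q) θ (univU _))
      (l2Rep ((p : ℝ) / q) θ (univV _)) →⋆ₐ[ℂ] ℂ) :
    χ ⟨l2Rep ((p : ℝ) / q) θ (univU _) ^ q, left_pow_mem q _ _⟩ = e (q * θ) := by
  have : (⟨l2Rep ((p : ℝ) / q) θ (univU _) ^ q, left_pow_mem q _ _⟩ :
      powerAlgebra q (l2Rep ((p : ℝ) / q) θ (univU _)) (l2Rep ((p : ℝ) / q) θ (univV _))) =
      algebraMap ℂ _ (e (q * θ)) := by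
    refine Subtype.ext ?_
    change l2Rep ((p : ℝ) / q) θ (univU _) ^ q = algebraMap ℂ _ (e (q * θ))
    rw [l2Rep_univU, momOp_pow, Algebra.algebraMap_eq_smul_one]
  rw [this]
  exact AlgHomClass.commutes χ _

/-- As `U ^ q` acts on `L²(𝕋)` as the scalar `e(q θ)`, only matrices with the given `θ` are needed. -/
theorem spectrum_l2Rep_subset (hpq : IsCoprime p (q : ℤ)) (θ : ℝ)
    {a : UniversalAlgebra ((p : ℝ) / q)} (ha : IsStarNormal a) :
    spectrum ℂ (l2Rep ((p : ℝ) / q) θ a) ⊆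
      closure (⋃ x : ℝ, spectrum ℂ (matrixRep p q x θ a)) := by
  refine spectrum_subset_closure_iUnion (fun x : ℝ => matrixRep p q x θ)
    (l2Rep ((p : ℝ) / q) θ) (fun b hb => ?_) a ha
  refine apply_eq_zero_of_matrixRep hpq (l2Rep ((p : ℝ) / q) θ) {y | y.2 = θ} (fun χ => ?_) b
    (fun y => by rw [y.2]; exact hb y.1.1)
  have hf := (univ_isFrame ((p : ℝ) / q)).map (l2Rep ((p : ℝ) / q) θ)
  obtain ⟨x, hx⟩ := exists_e_mul_eq (q := q) (norm_character_eq_one χ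
    (pow_mem hf.unitary_right q) (right_pow_mem q _ _))
  exact ⟨(x, θ), rfl, character_left_pow_l2Rep θ χ, hx⟩

/-- Every `x` occurs on `L²(𝕋)`, as the spectrum of multiplication by `ξ_q` is the full circle. -/
theorem spectrum_matrixRep_subset_l2Rep (hpq : IsCoprime p (q : ℤ)) (x θ : ℝ)
    {a : UniversalAlgebra ((p : ℝ) / q)} (ha : IsStarNormal a) :
    spectrum ℂ (matrixRep p q x θ a) ⊆ spectrum ℂ (l2Rep ((p : ℝ) / q) θ a) := by
  have hf := (univ_isFrame ((p : ℝ) / q)).map (l2Rep ((p : ℝ) / q) θ)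
  have hz : e (q * x) ∈ spectrum ℂ (l2Rep ((p : ℝ) / q) θ (univV _) ^ q) := by
    rw [l2Rep_univV]
    refine mem_spectrum_posOp_pow (NeZero.ne q) ?_
    exact CStarRing.norm_of_mem_unitary (Unitary.mem_iff.2 ⟨star_e_mul _, e_mul_star _⟩)
  obtain ⟨χ, hχ⟩ := exists_character_apply_eq (isClosed_powerAlgebra q _ _)
    (powerAlgebra_comm hf (isPrimitiveRoot_phase hpq).pow_eq_one)
    ⟨l2Rep ((p : ℝ) / q) θ (univV _) ^ q, right_pow_mem q _ _⟩ hz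
  exact spectrum_subset_of_ker _ _ (fun b hb => matrixRep_eq_zero_of_character hpq
    (l2Rep ((p : ℝ) / q) θ) χ (character_left_pow_l2Rep θ χ) hχ b hb) ha

end Kernels

end Harper

namespace Harper

/-! ### Reduction of the parameters modulo `1 / q`, and grids -/

section Grid

variable {q : ℕ} [NeZero q]

theorem e_mul_add_div (x : ℝ) (m : ℤ) : e (q * (x + m / q)) = e (q * x) := by
  have hq := q_ne_zero_real (q := q)
  rw [mul_add, mul_div_cancel₀ _ hq, e_add, e_int, mul_one]

theorem exists_mem_Ico_e_eq (x : ℝ) :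
    ∃ x' ∈ Set.Ico (0 : ℝ) (1 / q), e (q * x) = e (q * x') := by
  have hq : (0 : ℝ) < q := by exact_mod_cast NeZero.pos q
  refine ⟨x + (-⌊q * x⌋ : ℤ) / q, ⟨?_, ?_⟩, (e_mul_add_div x _).symm⟩
  · have := Int.floor_le (q * x)
    have h : x + (-⌊q * x⌋ : ℤ) / q = (q * x - ⌊q * x⌋) / q := by push_cast; field_simp; ring
    rw [h]
    exact div_nonneg (by linarith) hq.le
  · have := Int.lt_floor_add_one (q * x)
    have h : x + (-⌊q * x⌋ : ℤ) / q = (q * x - ⌊q * x⌋) / q := by push_cast; field_simp; ring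
    rw [h]
    exact div_lt_div_of_pos_right (by linarith) hq

/-- Modulo `1 / q`, every point is within half a step of the grid. -/
theorem exists_mem_grid {N : ℕ} (hN : 0 < N) (x₀ x : ℝ) :
    ∃ g ∈ grid q N x₀, ∃ x' : ℝ, e (q * x) = e (q * x') ∧ |x' - g| ≤ 1 / (2 * (N * q)) := by
  have hq : (0 : ℝ) < q := by exact_mod_cast NeZero.pos q
  have hN' : (0 : ℝ) < N := by exact_mod_cast hN
  have hNz : (0 : ℤ) < N := by exact_mod_cast hN
  set m : ℤ := round ((x - x₀) * (N * q)) with hm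
  -- the grid point nearest to `x` on `x₀ + ℤ / (N q)` is reduced modulo `1 / q`
  have hj : ((m % N).toNat : ℝ) = m - N * (m / N : ℤ) := by
    have h1 : ((m % N).toNat : ℤ) = m % N := Int.toNat_of_nonneg (Int.emod_nonneg _ hNz.ne')
    have h2 : m % N = m - N * (m / N) := Int.emod_def m N
    exact_mod_cast congrArg (Int.cast : ℤ → ℝ) (h1.trans h2)
  refine ⟨x₀ + (m % N).toNat / (N * q), ⟨_, ?_, rfl⟩, x + (-(m / N) : ℤ) / q,
    (e_mul_add_div x _).symm, ?_⟩
  · have := Int.emod_lt_of_pos m hNz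
    have := Int.emod_nonneg m hNz.ne'
    omega
  · have h : x + (-(m / N) : ℤ) / q - (x₀ + (m % N).toNat / (N * q)) =
        ((x - x₀) * (N * q) - m) / (N * q) := by
      rw [hj]
      push_cast
      field_simp
      ring
    rw [h, abs_div, abs_of_pos (mul_pos hN' hq)]
    have := abs_sub_round ((x - x₀) * (N * q))
    rw [← hm] at this
    calc _ ≤ (1 / 2) / ((N : ℝ) * q) := by gcongr
      _ = _ := by rw [div_div]

end Grid

/-! ### Lipschitz bounds for the matrices -/

section Lipschitz

variable {q : ℕ}

theorem isSelfAdjoint_cosDiag (k : ℤ) (y : ℝ) : IsSelfAdjoint (cosDiag q k y) := by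
  rw [isSelfAdjoint_iff, cosDiag, Matrix.star_eq_conjTranspose, Matrix.diagonal_conjTranspose]
  congr 1
  funext j
  exact Complex.conj_ofReal _

theorem norm_cosDiag_sub_le (k : ℤ) (y y' : ℝ) :
    ‖cosDiag q k y - cosDiag q k y'‖ ≤ 2 * Real.pi * |y - y'| := by
  rw [cosDiag, cosDiag, Matrix.diagonal_sub, Matrix.l2_opNorm_diagonal,
    pi_norm_le_iff_of_nonneg (by positivity)]
  intro j
  rw [← Complex.ofReal_sub, Complex.norm_real, Real.norm_eq_abs]
  refine (Real.abs_cos_sub_cos_le _ _).trans_eq ?_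
  rw [← mul_sub, add_sub_add_right_eq_sub, abs_mul, abs_of_pos Real.two_pi_pos]

variable [NeZero q]

theorem isSelfAdjoint_dft_conj (k : ℤ) (y : ℝ) :
    IsSelfAdjoint (dft q * cosDiag q k y * (dft q)⁻¹) := by
  rw [dft_inv]
  exact (isSelfAdjoint_cosDiag k y).conjugate _

theorem norm_dft_conj_sub_le (k : ℤ) (y y' : ℝ) :
    ‖dft q * cosDiag q k y * (dft q)⁻¹ - dft q * cosDiag q k y' * (dft q)⁻¹‖ ≤
      2 * Real.pi * |y - y'| := by
  rw [← sub_mul, ← mul_sub, dft_inv,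
    CStarRing.norm_mul_mem_unitary _ (Unitary.star_mem dft_mem_unitary),
    CStarRing.norm_mem_unitary_mul _ dft_mem_unitary]
  exact norm_cosDiag_sub_le k y y'

theorem star_neg_two_I (κ : ℝ) : star (-2 * Complex.I * κ : ℂ) = -(-2 * Complex.I * κ) := by
  change (starRingEnd ℂ) _ = _
  simp [Complex.conj_ofNat]

theorem star_neg_two_I_mul (κ lam : ℝ) :
    star (-2 * Complex.I * κ * lam : ℂ) = -(-2 * Complex.I * κ * lam) := by
  change (starRingEnd ℂ) _ = _
  simp [Complex.conj_ofNat]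

theorem norm_neg_two_I (κ : ℝ) : ‖(-2 * Complex.I * κ : ℂ)‖ = 2 * |κ| := by
  simp

theorem norm_harperMatrix_sub_le (κ : ℝ) (p : ℤ) (lam x θ x' θ' : ℝ) :
    ‖harperMatrix κ p q lam x θ - harperMatrix κ p q lam x' θ'‖ ≤
      4 * Real.pi * |κ| * (|x - x'| + |lam| * |θ - θ'|) := by
  have hsa : ∀ x θ : ℝ, IsSelfAdjoint
      (cosDiag q 1 x + (lam : ℂ) • (dft q * cosDiag q p θ * (dft q)⁻¹)) := fun x θ =>
    (isSelfAdjoint_cosDiag 1 x).add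
      (IsSelfAdjoint.smul (Complex.conj_ofReal lam) (isSelfAdjoint_dft_conj p θ))
  refine (norm_exp_sub_exp_le (star_smul_of_star_eq_neg (hsa x θ) (star_neg_two_I κ))
    (star_smul_of_star_eq_neg (hsa x' θ') (star_neg_two_I κ))).trans ?_
  rw [← smul_sub, norm_smul, norm_neg_two_I, add_sub_add_comm, ← smul_sub]
  have h1 := norm_cosDiag_sub_le (q := q) 1 x x'
  have h2 := norm_dft_conj_sub_le (q := q) p θ θ'
  calc _ ≤ 2 * |κ| * (2 * Real.pi * |x - x'| + |lam| * (2 * Real.pi * |θ - θ'|)) := by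
        gcongr
        refine (norm_add_le _ _).trans (add_le_add h1 ?_)
        rw [norm_smul, Complex.norm_real, Real.norm_eq_abs]
        gcongr
    _ = _ := by ring

theorem norm_kickedMatrix_sub_le (κ : ℝ) (p : ℤ) (lam x θ x' θ' : ℝ) :
    ‖kickedMatrix κ p q lam x θ - kickedMatrix κ p q lam x' θ'‖ ≤
      4 * Real.pi * |κ| * (|x - x'| + |lam| * |θ - θ'|) := by
  rw [kickedMatrix_eq_exp_mul_exp, kickedMatrix_eq_exp_mul_exp]
  refine (norm_mul_sub_mul_le
    (exp_smul_mem_unitary (isSelfAdjoint_dft_conj p θ) (star_neg_two_I_mul κ lam))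
    (exp_smul_mem_unitary (isSelfAdjoint_cosDiag 1 x') (star_neg_two_I κ))).trans ?_
  have h1 := norm_exp_sub_exp_le
    (star_smul_of_star_eq_neg (isSelfAdjoint_cosDiag (q := q) 1 x) (star_neg_two_I κ))
    (star_smul_of_star_eq_neg (isSelfAdjoint_cosDiag (q := q) 1 x') (star_neg_two_I κ))
  have h2 := norm_exp_sub_exp_le
    (star_smul_of_star_eq_neg (isSelfAdjoint_dft_conj (q := q) p θ) (star_neg_two_I_mul κ lam))
    (star_smul_of_star_eq_neg (isSelfAdjoint_dft_conj (q := q) p θ') (star_neg_two_I_mul κ lam))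
  rw [← smul_sub, norm_smul, norm_neg_two_I] at h1
  rw [← smul_sub, norm_smul, norm_mul, norm_neg_two_I, Complex.norm_real, Real.norm_eq_abs] at h2
  have h3 := norm_cosDiag_sub_le (q := q) 1 x x'
  have h4 := norm_dft_conj_sub_le (q := q) p θ θ'
  calc _ ≤ 2 * |κ| * (2 * Real.pi * |x - x'|) + 2 * |κ| * |lam| * (2 * Real.pi * |θ - θ'|) :=
        add_le_add (h1.trans (by gcongr)) (h2.trans (by gcongr))
    _ = _ := by ring

end Lipschitz

/-! ### Normality of the mother operators -/

section Mother

variable (κ α lam : ℝ)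

theorem isStarNormal_motherUnitaryHarper : IsStarNormal (motherUnitaryHarper κ α lam) := by
  have h : motherUnitaryHarper κ α lam ∈ unitary (UniversalAlgebra α) := by
    have := exp_smul_mem_unitary (a := (realPart (univV α) : UniversalAlgebra α) +
      (lam : ℂ) • (realPart (univU α) : UniversalAlgebra α))
      ((realPart (univV α)).2.add
        (IsSelfAdjoint.smul (Complex.conj_ofReal lam) (realPart (univU α)).2)) (star_neg_two_I κ)
    rwa [smul_add, smul_smul] at this
  exact isStarNormal_of_mem_unitary h

theorem isStarNormal_motherKickedHarper : IsStarNormal (motherKickedHarper κ α lam) := by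
  have h : motherKickedHarper κ α lam ∈ unitary (UniversalAlgebra α) :=
    mul_mem (exp_smul_mem_unitary (realPart (univV α)).2 (star_neg_two_I κ))
      (exp_smul_mem_unitary (realPart (univU α)).2 (star_neg_two_I_mul κ lam))
  exact isStarNormal_of_mem_unitary h

end Mother

/-! ### Spectra and their approximation -/

section Spectra

variable {p : ℤ} {q : ℕ} {a : UniversalAlgebra ((p : ℝ) / q)}
  {M : ℝ → ℝ → Matrix (Fin q) (Fin q) ℂ} {κ lam : ℝ}

theorem continuous_of_lipschitz_bound
    (hL : ∀ x θ x' θ', ‖M x θ - M x' θ'‖ ≤ 4 * Real.pi * |κ| * (|x - x'| + |lam| * |θ - θ'|)) :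
    Continuous fun y : ℝ × ℝ => M y.1 y.2 := by
  rw [continuous_iff_continuousAt]
  intro y
  refine tendsto_iff_norm_sub_tendsto_zero.2 ?_
  refine squeeze_zero (fun _ => norm_nonneg _) (fun z => hL z.1 z.2 y.1 y.2) ?_
  have : Continuous fun z : ℝ × ℝ =>
      4 * Real.pi * |κ| * (|z.1 - y.1| + |lam| * |z.2 - y.2|) := by fun_prop
  simpa using this.tendsto y

theorem exists_mem_spectrum_edist_le {A B : Matrix (Fin q) (Fin q) ℂ} (hB : IsStarNormal B) {r : ℝ}
    (h : ‖A - B‖ ≤ r) {z : ℂ} (hz : z ∈ spectrum ℂ A) :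
    ∃ w ∈ spectrum ℂ B, edist z w ≤ ENNReal.ofReal r := by
  obtain ⟨w, hw, hd⟩ := exists_mem_spectrum_dist_le hB hz
  exact ⟨w, hw, by rw [edist_dist]; exact ENNReal.ofReal_le_ofReal (hd.trans h)⟩

variable [NeZero q]

/-- The spectrum of an element of the rational rotation algebra is the union of the spectra of its
matrices. -/
theorem spectrum_eq_iUnion_matrixRep (hpq : IsCoprime p (q : ℤ)) (ha : IsStarNormal a)
    (hM : ∀ x θ, matrixRep p q x θ a = M x θ) (hc : Continuous fun y : ℝ × ℝ => M y.1 y.2) :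
    spectrum ℂ a = ⋃ x ∈ Set.Ico (0 : ℝ) (1 / q), ⋃ θ ∈ Set.Ico (0 : ℝ) (1 / q),
      spectrum ℂ (M x θ) := by
  have hred : ∀ x θ : ℝ, ∃ x' ∈ Set.Ico (0 : ℝ) (1 / q), ∃ θ' ∈ Set.Ico (0 : ℝ) (1 / q),
      spectrum ℂ (M x θ) = spectrum ℂ (M x' θ') := by
    intro x θ
    obtain ⟨x', hx', hx⟩ := exists_mem_Ico_e_eq (q := q) x
    obtain ⟨θ', hθ', hθ⟩ := exists_mem_Ico_e_eq (q := q) θ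
    refine ⟨x', hx', θ', hθ', ?_⟩
    rw [← hM, ← hM]
    exact spectrum_matrixRep_eq hpq hx hθ ha
  refine Set.Subset.antisymm ?_ ?_
  -- the union over the half-open period is closed, as it equals the union over the closed one
  · have hcl : IsClosed (⋃ y : Set.Icc (0 : ℝ) (1 / q) × Set.Icc (0 : ℝ) (1 / q),
        spectrum ℂ (M y.1 y.2)) :=
      isClosed_iUnion_spectrum (f := fun y : Set.Icc (0 : ℝ) (1 / q) × Set.Icc (0 : ℝ) (1 / q) =>
        M y.1 y.2) (hc.comp (by fun_prop :
          Continuous fun y : Set.Icc (0 : ℝ) (1 / q) × Set.Icc (0 : ℝ) (1 / q) =>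
            ((y.1 : ℝ), (y.2 : ℝ))))
    intro z hz
    have hz' := closure_minimal (Set.iUnion_subset fun y => ?_) hcl
      (spectrum_subset_closure_matrixRep hpq ha hz)
    · obtain ⟨y, hy⟩ := Set.mem_iUnion.1 hz'
      obtain ⟨x', hx', θ', hθ', h⟩ := hred y.1 y.2
      rw [h] at hy
      exact Set.mem_biUnion hx' (Set.mem_biUnion hθ' hy)
    · obtain ⟨x', hx', θ', hθ', h⟩ := hred y.1 y.2
      rw [hM, h]
      exact Set.subset_iUnion (fun y : Set.Icc (0 : ℝ) (1 / q) × Set.Icc (0 : ℝ) (1 / q) =>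
        spectrum ℂ (M y.1 y.2)) (⟨x', Set.Ico_subset_Icc_self hx'⟩, ⟨θ', Set.Ico_subset_Icc_self hθ'⟩)
  · refine Set.iUnion₂_subset fun x _ => Set.iUnion₂_subset fun θ _ => ?_
    rw [← hM]
    exact AlgHom.spectrum_apply_subset (matrixRep p q x θ) a

/-- The spectrum of the image of an element of the rational rotation algebra on `L²(𝕋)` is the union
of the spectra of its matrices with the given `θ`. -/
theorem spectrum_l2Rep_eq_iUnion (hpq : IsCoprime p (q : ℤ)) (ha : IsStarNormal a)
    (hM : ∀ x θ, matrixRep p q x θ a = M x θ) (hc : Continuous fun y : ℝ × ℝ => M y.1 y.2) (θ : ℝ) :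
    spectrum ℂ (l2Rep ((p : ℝ) / q) θ a) =
      ⋃ x ∈ Set.Ico (0 : ℝ) (1 / q), spectrum ℂ (M x θ) := by
  have hred : ∀ x : ℝ, ∃ x' ∈ Set.Ico (0 : ℝ) (1 / q),
      spectrum ℂ (M x θ) = spectrum ℂ (M x' θ) := by
    intro x
    obtain ⟨x', hx', hx⟩ := exists_mem_Ico_e_eq (q := q) x
    refine ⟨x', hx', ?_⟩
    rw [← hM, ← hM]
    exact spectrum_matrixRep_eq hpq hx rfl ha
  refine Set.Subset.antisymm ?_ ?_
  -- the union over the half-open period is closed, as it equals the union over the closed one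
  · have hcl : IsClosed (⋃ x : Set.Icc (0 : ℝ) (1 / q), spectrum ℂ (M x θ)) :=
      isClosed_iUnion_spectrum (f := fun x : Set.Icc (0 : ℝ) (1 / q) => M x θ)
        (hc.comp (by fun_prop : Continuous fun x : Set.Icc (0 : ℝ) (1 / q) => ((x : ℝ), θ)))
    intro z hz
    have hz' := closure_minimal (Set.iUnion_subset fun y => ?_) hcl
      (spectrum_l2Rep_subset hpq θ ha hz)
    · obtain ⟨y, hy⟩ := Set.mem_iUnion.1 hz'
      obtain ⟨x', hx', h⟩ := hred y
      rw [h] at hy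
      exact Set.mem_biUnion hx' hy
    · obtain ⟨x', hx', h⟩ := hred y
      rw [hM, h]
      exact Set.subset_iUnion (fun x : Set.Icc (0 : ℝ) (1 / q) => spectrum ℂ (M x θ))
        ⟨x', Set.Ico_subset_Icc_self hx'⟩
  · refine Set.iUnion₂_subset fun x _ => ?_
    rw [← hM]
    exact spectrum_matrixRep_subset_l2Rep hpq x θ ha

/-- The bound is the Lipschitz constant `4 π |κ|` of the matrices times half the step `1 / (N q)` of
the grid. -/
theorem hausdorffEDist_gridSpectrum_le (hpq : IsCoprime p (q : ℤ)) (ha : IsStarNormal a)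
    (hM : ∀ x θ, matrixRep p q x θ a = M x θ)
    (hL : ∀ x θ x' θ', ‖M x θ - M x' θ'‖ ≤ 4 * Real.pi * |κ| * (|x - x'| + |lam| * |θ - θ'|))
    (θ : ℝ) {N : ℕ} (hN : 0 < N) (x₀ : ℝ) :
    Metric.hausdorffEDist (gridSpectrum N x₀ fun x => M x θ)
      (spectrum ℂ (l2Rep ((p : ℝ) / q) θ a)) ≤ ENNReal.ofReal (2 * Real.pi * |κ| / (N * q)) := by
  have hnormal : ∀ x θ, IsStarNormal (M x θ) := fun x θ => hM x θ ▸ ha.map (matrixRep p q x θ)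
  refine Metric.hausdorffEDist_le_of_mem_edist (fun z hz => ⟨z, ?_, by simp⟩) fun z hz => ?_
  · obtain ⟨x, -, hx⟩ := Set.mem_iUnion₂.1 hz
    simp only [← hM] at hx
    exact spectrum_matrixRep_subset_l2Rep hpq x θ ha hx
  · rw [spectrum_l2Rep_eq_iUnion hpq ha hM (continuous_of_lipschitz_bound hL)] at hz
    obtain ⟨x, -, hx⟩ := Set.mem_iUnion₂.1 hz
    obtain ⟨g, hg, x', hx', hd⟩ := exists_mem_grid (q := q) hN x₀ x
    rw [← hM, spectrum_matrixRep_eq hpq hx' rfl ha, hM] at hx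
    have hle : ‖M x' θ - M g θ‖ ≤ 2 * Real.pi * |κ| / (N * q) :=
      calc _ ≤ 4 * Real.pi * |κ| * (|x' - g| + |lam| * |θ - θ|) := hL _ _ _ _
        _ = 4 * Real.pi * |κ| * |x' - g| := by simp
        _ ≤ 4 * Real.pi * |κ| * (1 / (2 * (N * q))) := by gcongr
        _ = _ := by field_simp; ring
    obtain ⟨w, hw, hzw⟩ := exists_mem_spectrum_edist_le (hnormal g θ) hle hx
    exact ⟨w, Set.mem_biUnion hg hw, hzw⟩

theorem hausdorffEDist_gridSpectrum₂_le (hpq : IsCoprime p (q : ℤ)) (ha : IsStarNormal a)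
    (hM : ∀ x θ, matrixRep p q x θ a = M x θ)
    (hL : ∀ x θ x' θ', ‖M x θ - M x' θ'‖ ≤ 4 * Real.pi * |κ| * (|x - x'| + |lam| * |θ - θ'|))
    {N : ℕ} (hN : 0 < N) (x₀ θ₀ : ℝ) :
    Metric.hausdorffEDist (gridSpectrum₂ N x₀ θ₀ M) (spectrum ℂ a) ≤
      ENNReal.ofReal (2 * Real.pi * |κ| * (1 + |lam|) / (N * q)) := by
  have hnormal : ∀ x θ, IsStarNormal (M x θ) := fun x θ => hM x θ ▸ ha.map (matrixRep p q x θ)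
  refine Metric.hausdorffEDist_le_of_mem_edist (fun z hz => ⟨z, ?_, by simp⟩) fun z hz => ?_
  · obtain ⟨x, -, hx⟩ := Set.mem_iUnion₂.1 hz
    obtain ⟨θ, -, hx⟩ := Set.mem_iUnion₂.1 hx
    rw [← hM] at hx
    exact AlgHom.spectrum_apply_subset (matrixRep p q x θ) a hx
  · rw [spectrum_eq_iUnion_matrixRep hpq ha hM (continuous_of_lipschitz_bound hL)] at hz
    obtain ⟨x, -, hx⟩ := Set.mem_iUnion₂.1 hz
    obtain ⟨θ, -, hx⟩ := Set.mem_iUnion₂.1 hx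
    obtain ⟨g, hg, x', hx', hd⟩ := exists_mem_grid (q := q) hN x₀ x
    obtain ⟨g', hg', θ', hθ', hd'⟩ := exists_mem_grid (q := q) hN θ₀ θ
    rw [← hM, spectrum_matrixRep_eq hpq hx' hθ' ha, hM] at hx
    have hle : ‖M x' θ' - M g g'‖ ≤ 2 * Real.pi * |κ| * (1 + |lam|) / (N * q) :=
      calc _ ≤ 4 * Real.pi * |κ| * (|x' - g| + |lam| * |θ' - g'|) := hL _ _ _ _
        _ ≤ 4 * Real.pi * |κ| * (1 / (2 * (N * q)) + |lam| * (1 / (2 * (N * q)))) := by gcongr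
        _ = _ := by field_simp; ring
    obtain ⟨w, hw, hzw⟩ := exists_mem_spectrum_edist_le (hnormal g g') hle hx
    exact ⟨w, Set.mem_biUnion hg (Set.mem_biUnion hg' hw), hzw⟩

end Spectra

end Harper

end

open Harper
theorem mainTheorem5 (p : ℤ) (q : ℕ) [NeZero q] (hpq : IsCoprime p (q : ℤ)) (κ lam : ℝ) :
    (∀ x θ : ℝ,
      UnitarilyEquivalent (kickedMatrix κ p q lam x θ)
          ((dft q)⁻¹ * Matrix.diagonal (kickPhase q κ 1 x) * dft q *
            Matrix.diagonal (kickPhase q (κ * lam) p θ)) ∧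
        (dft q)⁻¹ * Matrix.diagonal (kickPhase q κ 1 x) * dft q *
            Matrix.diagonal (kickPhase q (κ * lam) p θ) =
          rowCirculant (firstRow q κ x) * Matrix.diagonal (kickPhase q (κ * lam) p θ)) ∧
    (∀ θ : ℝ,
      spectrum ℂ (unitaryHarper κ (p / q) lam θ) =
          ⋃ x ∈ Set.Ico (0 : ℝ) (1 / q), spectrum ℂ (harperMatrix κ p q lam x θ) ∧
        spectrum ℂ (kickedHarper κ (p / q) lam θ) =
          ⋃ x ∈ Set.Ico (0 : ℝ) (1 / q), spectrum ℂ (kickedMatrix κ p q lam x θ)) ∧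
    (∀ θ : ℝ, ∀ N : ℕ, 0 < N → ∀ x₀ ∈ Set.Ico (0 : ℝ) (1 / (N * q)),
      Metric.hausdorffEDist
          (gridSpectrum N x₀ fun x => harperMatrix κ p q lam x θ)
          (spectrum ℂ (unitaryHarper κ (p / q) lam θ)) ≤
            ENNReal.ofReal (2 * Real.pi * |κ| / (N * q)) ∧
        Metric.hausdorffEDist
          (gridSpectrum N x₀ fun x => kickedMatrix κ p q lam x θ)
          (spectrum ℂ (kickedHarper κ (p / q) lam θ)) ≤
            ENNReal.ofReal (2 * Real.pi * |κ| / (N * q))) ∧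
    (spectrum ℂ (motherUnitaryHarper κ (p / q) lam) =
        ⋃ x ∈ Set.Ico (0 : ℝ) (1 / q), ⋃ θ ∈ Set.Ico (0 : ℝ) (1 / q),
          spectrum ℂ (harperMatrix κ p q lam x θ) ∧
      spectrum ℂ (motherKickedHarper κ (p / q) lam) =
        ⋃ x ∈ Set.Ico (0 : ℝ) (1 / q), ⋃ θ ∈ Set.Ico (0 : ℝ) (1 / q),
          spectrum ℂ (kickedMatrix κ p q lam x θ)) ∧
    (∀ N : ℕ, 0 < N →
      ∀ x₀ ∈ Set.Ico (0 : ℝ) (1 / (N * q)), ∀ θ₀ ∈ Set.Ico (0 : ℝ) (1 / (N * q)),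
        Metric.hausdorffEDist
            (gridSpectrum₂ N x₀ θ₀ fun x θ => harperMatrix κ p q lam x θ)
            (spectrum ℂ (motherUnitaryHarper κ (p / q) lam)) ≤
              ENNReal.ofReal (2 * Real.pi * |κ| * (1 + |lam|) / (N * q)) ∧
          Metric.hausdorffEDist
            (gridSpectrum₂ N x₀ θ₀ fun x θ => kickedMatrix κ p q lam x θ)
            (spectrum ℂ (motherKickedHarper κ (p / q) lam)) ≤
              ENNReal.ofReal (2 * Real.pi * |κ| * (1 + |lam|) / (N * q))) := by
  have hLH := norm_harperMatrix_sub_le (q := q) κ p lam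
  have hLK := norm_kickedMatrix_sub_le (q := q) κ p lam
  have hMH := fun x θ => matrixRep_motherUnitaryHarper (q := q) p x θ κ lam
  have hMK := fun x θ => matrixRep_motherKickedHarper (q := q) p x θ κ lam
  have hnH := isStarNormal_motherUnitaryHarper κ ((p : ℝ) / q) lam
  have hnK := isStarNormal_motherKickedHarper κ ((p : ℝ) / q) lam
  have hcH := continuous_of_lipschitz_bound hLH
  have hcK := continuous_of_lipschitz_bound hLK
  simp only [← l2Rep_motherUnitaryHarper, ← l2Rep_motherKickedHarper]
  refine ⟨fun x θ => ⟨unitarilyEquivalent_kickedMatrix κ p lam x θ, ?_⟩,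
    fun θ => ⟨spectrum_l2Rep_eq_iUnion hpq hnH hMH hcH θ,
      spectrum_l2Rep_eq_iUnion hpq hnK hMK hcK θ⟩,
    fun θ N hN x₀ _ => ⟨hausdorffEDist_gridSpectrum_le hpq hnH hMH hLH θ hN x₀,
      hausdorffEDist_gridSpectrum_le hpq hnK hMK hLK θ hN x₀⟩,
    ⟨spectrum_eq_iUnion_matrixRep hpq hnH hMH hcH, spectrum_eq_iUnion_matrixRep hpq hnK hMK hcK⟩,
    fun N hN x₀ _ θ₀ _ => ⟨hausdorffEDist_gridSpectrum₂_le hpq hnH hMH hLH hN x₀ θ₀,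
      hausdorffEDist_gridSpectrum₂_le hpq hnK hMK hLK hN x₀ θ₀⟩⟩
  rw [dft_conj_eq_rowCirculant]
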